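/- For a closed set $\Sigma\subset\mathbb R$ and an external field $Q:\Sigma\to\,]-\infty,+\infty]$, the energy of a probability measure $\mu$ on $\Sigma$ is $$E_{Q,\Sigma}(\mu)=\int_\Sigma\int_\Sigma\log\frac1{|x-y|}\,\mu(dx)\mu(dy)+\int_\Sigma Q(x)\,\mu(dx),$$ read as the integral of $\log\frac1{|x-y|}+\frac12Q(x)+\frac12Q(y)$ with respect to $\mu\otimes\mu$ (a function that is bounded from below in the cases below; it is $+\infty$ for $x=y$). The equilibrium measure of $(\Sigma,Q)$ is the unique probability measure on $\Sigma$ whose energy equals $\inf_\rho E_{Q,\Sigma}(\rho)$, the infimum over all probability measures $\rho$ on $\Sigma$. Let $\Sigma_\sigma=[\sigma,+\infty[$ and $Q_\alpha(x)=x^2+2\alpha\log\frac1x$, where $\sigma\ge0$ if $\alpha>0$ (and then $Q_\alpha(0)=+\infty$), while for $\alpha=0$ we put $Q_0(x)=x^2$ and allow every $\sigma\in\mathbb R$. For $x,a>0$ put $$\varphi_\alpha(x,a)=x+a-\frac{2\alpha}{\sqrt{ax}},\qquad \psi_\alpha(x,a)=\tfrac34(x-a)^2+a(x-a)+2\alpha\sqrt{\tfrac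 ax}-2\alpha-2 .$$ **Theorem.** Let $\alpha>0$. There is exactly one pair $(a_c,b_c)$ with $0<a_c<b_c$, $\varphi_\alpha(b_c,a_c)=0$ and $\psi_\alpha(b_c,a_c)=0$. It satisfies $$0<a_c<\sqrt\alpha<b_c,\qquad b_c=\tfrac23\Big(\sqrt{6(\alpha+1)-2a_c^2}-\tfrac{a_c}2\Big),$$ and the following hold. 1. The equilibrium measure of $(\Sigma_0,Q_\alpha)$ has support $[a_c,b_c]$ and there the density (non-negative, as are all the densities below) $$f_{\alpha,0}(x)=\frac1\pi\sqrt{(b_c-x)(x-a_c)}\Big(1+\frac{\alpha}{\sqrt{a_cb_c}}\frac1x\Big).$$ Moreover $(a_c,b_c)$ is the only pair $(a,b)$ with $0<a<\sqrt\alpha<b$ for which the equilibrium measure of $(\Sigma_0,Q_\alpha)$ is carried by $[a,b]$ with the density $\frac1\pi\sqrt{(b-x)(x-a)}\big(1+\frac{\alpha}{\sqrt{ab}}\frac1x\big)$. 2. If $0<\sigma\le a_c$, the equilibrium measure of $(\Sigma_\sigma,Q_\alpha)$ is the same measure as in (1). 3. If $\sigma>a_c$, there is exactly one $b>\sigma$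 with $\varphi_\alpha(b,\sigma)\ge0$ and $\psi_\alpha(b,\sigma)=0$. For this $b$, the equilibrium measure of $(\Sigma_\sigma,Q_\alpha)$ is carried by $]\sigma,b]$, has topological support $[\sigma,b]$, and has on $]\sigma,b]$ the density $$f_{\alpha,\sigma}(x)=\frac1{2\pi}\sqrt{\frac{b-x}{x-\sigma}}\Big(2x+b-\sigma-2\alpha\sqrt{\frac\sigma b}\,\frac1x\Big).$$ Let $\alpha=0$ and $\sigma\in\mathbb R$. 4. (a) If $\sigma\ge-\sqrt2$, put $b=\frac23\big(\sqrt{\sigma^2+6}+\frac\sigma2\big)$. Then $b>\sigma$, and the equilibrium measure of $(\Sigma_\sigma,Q_0)$ is carried by $]\sigma,b]$, has topological support $[\sigma,b]$, and has on $]\sigma,b]$ the density $$f_{0,\sigma}(x)=\frac1{2\pi}\sqrt{\frac{b-x}{x-\sigma}}\,(2x+b-\sigma).$$ (b) If $\sigma\le-\sqrt2$, the equilibrium measure of $(\Sigma_\sigma,Q_0)$ is the semicircle law, with density $f_0(x)=\frac1\pi\sqrt{2-x^2}$ and support $[-\sqrt2,\sqrt2]$. -/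

import Mathlib

open MeasureTheory Set

noncomputable section

namespace LogEquilibrium

/-- The Lebesgue integral of an extended-real function: integral of the positive part minus
integral of the negative part. (Below it is only applied to probability measures and to functions
bounded from below, so that the negative part has a finite integral.) -/
def extIntegral {X : Type*} [MeasurableSpace X] (μ : Measure X) (f : X → EReal) : EReal :=
  ((∫⁻ x, (f x).toENNReal ∂μ : ENNReal) : EReal) -
    ((∫⁻ x, (-f x).toENNReal ∂μ : ENNReal) : EReal)

/-- The logarithmic kernel `log (1 / |x - y|)`, equal to `+∞` on the diagonal. -/
def logKernel (x y : ℝ) : EReal :=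
  if x = y then ⊤ else ((Real.log (1 / |x - y|) : ℝ) : EReal)

/-- The energy `∬ log (1 / |x - y|) μ(dx) μ(dy) + ∫ Q(x) μ(dx)` of a probability measure `μ` in the
external field `Q`. As usual, the two terms are put under one integral sign, with the kernel
`log (1 / |x - y|) + Q(x) / 2 + Q(y) / 2`: this kernel is bounded from below as soon as
`Q(x) - log (1 + x ^ 2)` is, so that the energy is a well defined element of `]-∞, +∞]` for every
probability measure, also where the sum of the two terms would read `(-∞) + (+∞)`. -/
def energy (Q : ℝ → EReal) (μ : Measure ℝ) : EReal :=
  extIntegral (μ.prod μ) fun p =>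
    logKernel p.1 p.2 + (((1 / 2 : ℝ) : EReal) * Q p.1 + ((1 / 2 : ℝ) : EReal) * Q p.2)

/-- The set of probability measures on the closed set `S`. -/
def probMeasuresOn (S : Set ℝ) : Set (Measure ℝ) :=
  {μ | IsProbabilityMeasure μ ∧ μ Sᶜ = 0}

/-- The minimal energy: the infimum of the energies of all the probability measures on `S`. -/
def minEnergy (Q : ℝ → EReal) (S : Set ℝ) : EReal :=
  ⨅ μ ∈ probMeasuresOn S, energy Q μ

/-- `μ` is the equilibrium measure of the external field `Q` on `S`: it is the one and only
probability measure on `S` whose energy is the minimal energy. -/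
def IsEquilibriumMeasure (Q : ℝ → EReal) (S : Set ℝ) (μ : Measure ℝ) : Prop :=
  μ ∈ probMeasuresOn S ∧ energy Q μ = minEnergy Q S ∧
    ∀ ρ ∈ probMeasuresOn S, energy Q ρ = minEnergy Q S → ρ = μ

/-- The external field `Q_α(x) = x ^ 2 + 2 α log (1 / x)`, with `Q_α(0) = +∞` if `α > 0`, and
`Q_0(x) = x ^ 2` for every real `x`. (For `α > 0` it is only used on `[0, +∞[`.) -/
def extField (α : ℝ) (x : ℝ) : EReal :=
  if 0 < α ∧ x = 0 then ⊤ else ((x ^ 2 + 2 * α * Real.log (1 / x) : ℝ) : EReal)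

/-- The function `φ_α(x, a) = x + a - 2 α / √(a x)`. -/
def phi (α x a : ℝ) : ℝ :=
  x + a - 2 * α / √(a * x)

/-- The function `ψ_α(x, a) = (3 / 4) (x - a) ^ 2 + a (x - a) + 2 α √(a / x) - 2 α - 2`. -/
def psi (α x a : ℝ) : ℝ :=
  3 / 4 * (x - a) ^ 2 + a * (x - a) + 2 * α * √(a / x) - 2 * α - 2

/-- The measure on the line that is carried by `S` and has there the density `f` (which is meant
to be non-negative on `S`) with respect to the Lebesgue measure. -/
def densityMeasure (S : Set ℝ) (f : ℝ → ℝ) : Measure ℝ :=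
  (volume.restrict S).withDensity fun x => ENNReal.ofReal (f x)

/-- The density `(1 / π) √((b - x) (x - a)) (1 + (α / √(a b)) (1 / x))`. -/
def softDensity (α a b x : ℝ) : ℝ :=
  1 / Real.pi * √((b - x) * (x - a)) * (1 + α / √(a * b) * (1 / x))

/-- The density `(1 / (2 π)) √((b - x) / (x - σ)) (2 x + b - σ - 2 α √(σ / b) (1 / x))`. -/
def hardDensity (α σ b x : ℝ) : ℝ :=
  1 / (2 * Real.pi) * √((b - x) / (x - σ)) * (2 * x + b - σ - 2 * α * √(σ / b) * (1 / x))

/-- The density `(1 / (2 π)) √((b - x) / (x - σ)) (2 x + b - σ)`. -/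
def hardDensityZero (σ b x : ℝ) : ℝ :=
  1 / (2 * Real.pi) * √((b - x) / (x - σ)) * (2 * x + b - σ)

/-- The semicircle density `(1 / π) √(2 - x ^ 2)`. -/
def semicircleDensity (x : ℝ) : ℝ :=
  1 / Real.pi * √(2 - x ^ 2)

end LogEquilibrium

end

/-! Two ingredients: the logarithmic energy is strictly convex, so the Euler-Lagrange conditions
characterise the minimiser, and those conditions can be checked explicitly in the Joukowski
coordinate.

Convexity (`log_energy_nonneg`). Frullani's integral for the triangle function `T(s) = (1 - s)₊`
writes `-log |x - y|` as the integral over `t > 0` of `(T(t |x - y|) - T(t)) / t`, and `T(t |x -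
y|)` is `t` times the measure of the set of `z` with `x` and `y` both in `[z, z + 1/t]`. So the
energy of a difference `ρ - μ` of probability measures is the integral over `t` and `z` of the
square of `(ρ - μ)([z, z + 1/t])`: it is nonnegative, and zero only if `ρ = μ`. Consequently
(`isEquilibriumMeasure_of_variational`), `μ` is the equilibrium measure as soon as `Q/2 - ∫ log |x -
y| μ(dy)` is a constant `c` almost everywhere for `μ` and at least `c` on the whole set.

Explicit potentials. With midpoint `m` and half-length `h` of `[a, b]`, put `x = m + h cos θ` and `y
= m + (h/2)(z + 1/z)`. Then `y - x` splits into two factors `exp(± iθ) - z`, and the potential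
becomes an integral of `log |ζ - z|` over the unit circle (`potential_arcMeasure`). For an angular
weight made of `1`, `cos θ`, `cos 2θ` and a Poisson kernel at the preimage `-r` of the origin, that
integral is elementary. The coefficients are those for which the potential matches `x² / 2 - α log
x` on the support up to a constant.

The meaning of `psi` and `phi`. The condition `psi = 0` says that the weight vanishes at the right
end point, so that it factors as `b - x` times the increasing `edgeFactor`; `phi / 2` is the value
of that factor at `a`. If `phi ≥ 0` the density is nonnegative, and the effective potential grows to
the right of `b`. If `phi = 0` it also grows to the left of `a`, so the same measure serves for
every wall at or to the left of `a` (`EdgeData.isEquilibriumMeasure`).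

What remains is algebra: in terms of `s = a + b` and `p = √(a b)`, the critical equations are `s p =
2 α` and `(3/4) s² - p² = 2 (α + 1)`, with one solution; for a hard wall, intermediate values and
the monotonicity of `psi` where `phi ≥ 0` give exactly one right end point. -/

namespace LogEquilibrium

/-! ### Positive definiteness of the logarithmic kernel. -/

open MeasureTheory Set Filter Topology

/-- The triangle function `s ↦ (1 - s)₊`. -/
noncomputable def triangle (s : ℝ) : ℝ := max (1 - s) 0

lemma continuous_triangle : Continuous triangle := by unfold triangle; fun_prop

lemma triangle_nonneg (s : ℝ) : 0 ≤ triangle s := le_max_right _ _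

lemma triangle_le_one {s : ℝ} (hs : 0 ≤ s) : triangle s ≤ 1 := max_le (by linarith) zero_le_one

lemma triangle_antitone : Antitone triangle := fun _ _ h => max_le_max (by linarith) le_rfl

lemma abs_triangle_sub_le (s t : ℝ) : |triangle s - triangle t| ≤ |s - t| := by
  refine (abs_max_sub_max_le_abs _ _ _).trans_eq ?_
  rw [abs_sub_comm]; congr 1; ring

/-- The Frullani integrand representing `-log u`. -/
noncomputable def logFrullani (t u : ℝ) : ℝ := t⁻¹ * (triangle (u * t) - triangle t)

lemma integrableOn_logFrullani {u : ℝ} (hu : 0 < u) :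
    IntegrableOn (fun t => logFrullani t u) (Ioi 0) := by
  -- Beyond `M` both triangle terms vanish; on `(0, M]` the Lipschitz bound for `triangle` cancels
  -- the factor `t⁻¹`.
  set M := max 1 u⁻¹
  have h1 : IntegrableOn (fun t => logFrullani t u) (Ioc 0 M) := by
    refine Measure.integrableOn_of_bounded (M := |u - 1|) (by simp) ?_ ?_
    · unfold logFrullani
      exact (measurable_inv.mul ((continuous_triangle.measurable.comp (by fun_prop)).sub
        continuous_triangle.measurable)).aestronglyMeasurable
    · filter_upwards [ae_restrict_mem measurableSet_Ioc] with t ht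
      rw [logFrullani, norm_mul, norm_inv, Real.norm_eq_abs, Real.norm_eq_abs, abs_of_pos ht.1,
        inv_mul_le_iff₀ ht.1]
      refine (abs_triangle_sub_le _ _).trans_eq ?_
      rw [show u * t - t = t * (u - 1) by ring, abs_mul, abs_of_pos ht.1]
  have h2 : IntegrableOn (fun t => logFrullani t u) (Ioi M) := by
    refine (integrableOn_zero).congr_fun (fun t ht => ?_) measurableSet_Ioi
    have ht1 : 1 ≤ t := (le_max_left _ _).trans (le_of_lt ht)
    have ht2 : u⁻¹ ≤ t := (le_max_right _ _).trans (le_of_lt ht)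
    have : 1 ≤ u * t := by rwa [inv_le_iff_one_le_mul₀' hu] at ht2
    simp [logFrullani, triangle, max_eq_right (sub_nonpos.2 ht1), max_eq_right (sub_nonpos.2 this)]
  have hM : (0 : ℝ) ≤ M := zero_le_one.trans (le_max_left _ _)
  rw [← Ioc_union_Ioi_eq_Ioi hM]
  exact h1.union h2

/-- Frullani's formula, with the limits `1` at zero and `0` at infinity of the triangle function. -/
lemma integral_logFrullani {u : ℝ} (hu : 0 < u) :
    ∫ t in Ioi 0, logFrullani t u = -Real.log u := by
  have h := Frullani.integral_Ioi_eq (f := triangle) (a := u) (b := 1) (L := 1) (R := 0)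
    (continuous_triangle.locallyIntegrable.locallyIntegrableOn _) hu one_pos ?_ ?_ ?_
  · simpa [logFrullani] using h
  · have := continuous_triangle.tendsto 0
    simp only [triangle] at this
    norm_num at this
    exact this.mono_left nhdsWithin_le_nhds
  · refine tendsto_const_nhds.congr' ?_
    filter_upwards [eventually_ge_atTop 1] with t ht
    simp [triangle, ht]
  · simpa [logFrullani] using integrableOn_logFrullani hu

/-- Since `triangle` is antitone, the integrand keeps one sign in `t`. Thus integrability of `log |x
- y|` is all that Fubini's theorem will require. -/
lemma integral_abs_logFrullani {u : ℝ} (hu : 0 < u) :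
    ∫ t in Ioi 0, |logFrullani t u| = |Real.log u| := by
  rcases le_total u 1 with h | h
  · rw [abs_of_nonpos (Real.log_nonpos hu.le h), ← integral_logFrullani hu]
    refine setIntegral_congr_fun measurableSet_Ioi fun t (ht : 0 < t) => abs_of_nonneg ?_
    exact mul_nonneg (inv_nonneg.2 ht.le) (sub_nonneg.2 (triangle_antitone (by nlinarith)))
  · rw [abs_of_nonneg (Real.log_nonneg h), ← neg_neg (Real.log u), ← integral_logFrullani hu,
      ← integral_neg]
    refine setIntegral_congr_fun measurableSet_Ioi fun t (ht : 0 < t) => abs_of_nonpos ?_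
    exact mul_nonpos_of_nonneg_of_nonpos (inv_nonneg.2 ht.le)
      (sub_nonpos.2 (triangle_antitone (by nlinarith)))

/-- The mean of the triangle kernel `(1 - t |x - y|)₊` for a measure on the plane. -/
noncomputable def triangleMean (τ : Measure (ℝ × ℝ)) (t : ℝ) : ℝ :=
  ∫ p, triangle (|p.1 - p.2| * t) ∂τ

lemma integrable_triangle (τ : Measure (ℝ × ℝ)) [IsFiniteMeasure τ] {t : ℝ} (ht : 0 < t) :
    Integrable (fun p : ℝ × ℝ => triangle (|p.1 - p.2| * t)) τ := by
  refine Integrable.of_bound (C := 1)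
    (continuous_triangle.comp (by fun_prop)).aestronglyMeasurable (ae_of_all _ fun p => ?_)
  rw [Real.norm_eq_abs, abs_of_nonneg (triangle_nonneg _)]
  exact triangle_le_one (by positivity)

/-- Fubini's theorem for the Frullani representation. The term `triangle t` does not depend on `τ`,
so it cancels in the energy of a difference of probability measures. -/
lemma log_integral_eq (τ : Measure (ℝ × ℝ)) [IsProbabilityMeasure τ]
    (hdiag : ∀ᵐ p ∂τ, p.1 ≠ p.2) (hint : Integrable (fun p => Real.log |p.1 - p.2|) τ) :
    IntegrableOn (fun t => t⁻¹ * (triangleMean τ t - triangle t)) (Ioi 0) ∧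
    ∫ t in Ioi 0, t⁻¹ * (triangleMean τ t - triangle t) = -∫ p, Real.log |p.1 - p.2| ∂τ := by
  have hmeas : Measurable fun q : (ℝ × ℝ) × ℝ => logFrullani q.2 |q.1.1 - q.1.2| := by
    unfold logFrullani
    exact (measurable_inv.comp measurable_snd).mul
      ((continuous_triangle.measurable.comp (by fun_prop)).sub
        (continuous_triangle.measurable.comp (by fun_prop)))
  have hI : Integrable (fun q : (ℝ × ℝ) × ℝ => logFrullani q.2 |q.1.1 - q.1.2|)
      (τ.prod (volume.restrict (Ioi 0))) := by
    rw [integrable_prod_iff hmeas.aestronglyMeasurable]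
    refine ⟨?_, ?_⟩
    · filter_upwards [hdiag] with p hp
      exact integrableOn_logFrullani (abs_pos.2 (sub_ne_zero.2 hp))
    · refine hint.abs.congr ?_
      filter_upwards [hdiag] with p hp
      exact (integral_abs_logFrullani (abs_pos.2 (sub_ne_zero.2 hp))).symm
  have hinner : ∀ t ∈ Ioi (0 : ℝ), ∫ p, logFrullani t |p.1 - p.2| ∂τ =
      t⁻¹ * (triangleMean τ t - triangle t) := by
    intro t ht
    simp only [logFrullani]
    rw [integral_const_mul, integral_sub (integrable_triangle τ ht) (integrable_const _)]
    simp [triangleMean]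
  constructor
  · have := hI.integral_prod_right
    exact IntegrableOn.congr_fun this hinner measurableSet_Ioi
  · rw [← setIntegral_congr_fun measurableSet_Ioi hinner, ← integral_neg]
    have hsw := integral_integral_swap (f := fun (p : ℝ × ℝ) t => logFrullani t |p.1 - p.2|) hI
    rw [← hsw]
    refine integral_congr_ae ?_
    filter_upwards [hdiag] with p hp
    exact integral_logFrullani (abs_pos.2 (sub_ne_zero.2 hp))

/-- Both points lie in `[z, z + r]` exactly when `max x y - r ≤ z ≤ min x y`. -/
lemma integral_indicator_window (x y r : ℝ) :
    ∫⁻ z, (Icc z (z + r)).indicator 1 x * (Icc z (z + r)).indicator 1 y =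
      ENNReal.ofReal (r - |x - y|) := by
  have : (fun z : ℝ => (Icc z (z + r)).indicator (1 : ℝ → ENNReal) x *
      (Icc z (z + r)).indicator 1 y) = (Icc (max x y - r) (min x y)).indicator 1 := by
    ext z
    simp only [indicator, mem_Icc, Pi.one_apply, ite_mul, one_mul, zero_mul, ← ite_and]
    congr 1
    simp only [eq_iff_iff, le_min_iff, sub_le_iff_le_add, max_le_iff]
    tauto
  rw [this, lintegral_indicator_one measurableSet_Icc, Real.volume_Icc]
  congr 1
  rw [abs_sub_comm, ← max_sub_min_eq_abs']
  rw [max_comm, min_comm]; ring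

lemma lintegral_window (ρ μ : Measure ℝ) [SFinite ρ] [SFinite μ] (r : ℝ) :
    ∫⁻ z, ρ (Icc z (z + r)) * μ (Icc z (z + r)) =
      ∫⁻ p, ENNReal.ofReal (r - |p.1 - p.2|) ∂(ρ.prod μ) := by
  have hm : MeasurableSet {q : ℝ × (ℝ × ℝ) | q.1 ≤ q.2.1 ∧ q.2.1 ≤ q.1 + r ∧ q.1 ≤ q.2.2 ∧
      q.2.2 ≤ q.1 + r} := by
    apply IsClosed.measurableSet
    simp only [ofPred_and]
    refine IsClosed.inter ?_ (IsClosed.inter ?_ (IsClosed.inter ?_ ?_)) <;>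
    exact isClosed_le (by fun_prop) (by fun_prop)
  have h1 : ∀ z, ρ (Icc z (z + r)) * μ (Icc z (z + r)) =
      ∫⁻ p, (Icc z (z + r)).indicator 1 p.1 * (Icc z (z + r)).indicator 1 p.2 ∂(ρ.prod μ) := by
    intro z
    rw [lintegral_prod_mul (f := (Icc z (z + r)).indicator 1) (g := (Icc z (z + r)).indicator 1)
      (measurable_one.indicator measurableSet_Icc).aemeasurable
      (measurable_one.indicator measurableSet_Icc).aemeasurable]
    simp [lintegral_indicator_one measurableSet_Icc]
  simp_rw [h1]
  rw [lintegral_lintegral_swap]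
  · simp_rw [integral_indicator_window]
  · refine Measurable.aemeasurable ?_
    convert (measurable_one (α := ENNReal)).indicator hm using 1
    ext q
    simp only [Function.uncurry, indicator, mem_Icc, Pi.one_apply, ite_mul, one_mul, zero_mul,
      ← ite_and, mem_ofPred_eq, and_assoc]

/-- The triangle is the overlap of two windows: for length `t⁻¹` the overlap `(t⁻¹ - |x - y|)₊`
equals `t⁻¹` times the triangle kernel. Exchanging the integrals decouples the two variables. -/
lemma triangleMean_eq (ρ μ : Measure ℝ) [IsProbabilityMeasure ρ] [IsProbabilityMeasure μ]
    {t : ℝ} (ht : 0 < t) :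
    Integrable (fun z => ρ.real (Icc z (z + t⁻¹)) * μ.real (Icc z (z + t⁻¹))) ∧
    triangleMean (ρ.prod μ) t =
      t * ∫ z, ρ.real (Icc z (z + t⁻¹)) * μ.real (Icc z (z + t⁻¹)) := by
  have hmeas (ν : Measure ℝ) [IsProbabilityMeasure ν] :
      Measurable fun z => ν (Icc z (z + t⁻¹)) := by
    have hm : MeasurableSet {q : ℝ × ℝ | q.1 ≤ q.2 ∧ q.2 ≤ q.1 + t⁻¹} := by
      apply IsClosed.measurableSet
      simp only [ofPred_and]
      exact IsClosed.inter (isClosed_le (by fun_prop) (by fun_prop))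
        (isClosed_le (by fun_prop) (by fun_prop))
    exact measurable_measure_prodMk_left (ν := ν) hm
  have key := lintegral_window ρ μ t⁻¹
  have htri : ∀ p : ℝ × ℝ, t⁻¹ * triangle (|p.1 - p.2| * t) = max (t⁻¹ - |p.1 - p.2|) 0 := by
    intro p
    rw [triangle, mul_max_of_nonneg _ _ (inv_nonneg.2 ht.le)]
    congr 1
    · field_simp
    · simp
  have hfin : ∫⁻ p, ENNReal.ofReal (t⁻¹ - |p.1 - p.2|) ∂(ρ.prod μ) =
      ENNReal.ofReal (∫ p, t⁻¹ * triangle (|p.1 - p.2| * t) ∂(ρ.prod μ)) := by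
    rw [ofReal_integral_eq_lintegral_ofReal ((integrable_triangle _ ht).const_mul _)
      (ae_of_all _ fun p => mul_nonneg (inv_nonneg.2 ht.le) (triangle_nonneg _))]
    refine lintegral_congr fun p => ?_
    rw [htri]; simp [ENNReal.ofReal_max]
  have hint : Integrable (fun z => ρ.real (Icc z (z + t⁻¹)) * μ.real (Icc z (z + t⁻¹))) := by
    refine ⟨((hmeas ρ).ennreal_toReal.mul (hmeas μ).ennreal_toReal).aestronglyMeasurable, ?_⟩
    rw [hasFiniteIntegral_iff_ofReal (ae_of_all _ fun z => by positivity)]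
    have : ∀ z, ENNReal.ofReal (ρ.real (Icc z (z + t⁻¹)) * μ.real (Icc z (z + t⁻¹))) =
        ρ (Icc z (z + t⁻¹)) * μ (Icc z (z + t⁻¹)) := fun z => by
      rw [ENNReal.ofReal_mul measureReal_nonneg, ofReal_measureReal, ofReal_measureReal]
    simp_rw [this, key, hfin]
    exact ENNReal.ofReal_lt_top
  refine ⟨hint, ?_⟩
  rw [integral_eq_lintegral_of_nonneg_ae (ae_of_all _ fun z => by positivity)
    hint.aestronglyMeasurable]
  have : ∀ z, ENNReal.ofReal (ρ.real (Icc z (z + t⁻¹)) * μ.real (Icc z (z + t⁻¹))) =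
      ρ (Icc z (z + t⁻¹)) * μ (Icc z (z + t⁻¹)) := fun z => by
    rw [ENNReal.ofReal_mul measureReal_nonneg, ofReal_measureReal, ofReal_measureReal]
  simp_rw [this]
  rw [key, hfin, ENNReal.toReal_ofReal, integral_const_mul, triangleMean]
  · rw [mul_inv_cancel_left₀ ht.ne']
  · exact integral_nonneg fun p => mul_nonneg (inv_nonneg.2 ht.le) (triangle_nonneg _)

/-- The triangle-kernel energy of `ρ - μ`, as an integral of a square. -/
lemma triangleMean_sub_sub (ρ μ : Measure ℝ) [IsProbabilityMeasure ρ] [IsProbabilityMeasure μ]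
    {t : ℝ} (ht : 0 < t) :
    Integrable (fun z => (ρ.real (Icc z (z + t⁻¹)) - μ.real (Icc z (z + t⁻¹))) ^ 2) ∧
    triangleMean (ρ.prod ρ) t + triangleMean (μ.prod μ) t - 2 * triangleMean (ρ.prod μ) t =
      t * ∫ z, (ρ.real (Icc z (z + t⁻¹)) - μ.real (Icc z (z + t⁻¹))) ^ 2 := by
  obtain ⟨i1, e1⟩ := triangleMean_eq ρ ρ ht
  obtain ⟨i2, e2⟩ := triangleMean_eq μ μ ht
  obtain ⟨i3, e3⟩ := triangleMean_eq ρ μ ht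
  have hsq : (fun z => (ρ.real (Icc z (z + t⁻¹)) - μ.real (Icc z (z + t⁻¹))) ^ 2) =
      fun z => (ρ.real (Icc z (z + t⁻¹)) * ρ.real (Icc z (z + t⁻¹)) +
        μ.real (Icc z (z + t⁻¹)) * μ.real (Icc z (z + t⁻¹))) -
        2 * (ρ.real (Icc z (z + t⁻¹)) * μ.real (Icc z (z + t⁻¹))) := by
    ext z; ring
  rw [hsq]
  refine ⟨(i1.add i2).sub (i3.const_mul 2), ?_⟩
  rw [integral_sub (by exact i1.add i2) (i3.const_mul 2), integral_add i1 i2, integral_const_mul,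
    e1, e2, e3]
  ring

/-- Along admissible `t` tending to `0` the windows `[z, z + t⁻¹]` exhaust `[z, ∞)`, so the measures
agree on `[z, ∞)` for almost every `z`. Such `z` increase to any given `a`, and continuity from
above gives agreement on every closed half-line. -/
lemma measure_eq_of_windows (ρ μ : Measure ℝ) [IsProbabilityMeasure ρ] [IsProbabilityMeasure μ]
    (h : ∀ᵐ t ∂(volume.restrict (Ioi (0 : ℝ))), ∀ᵐ z,
      ρ (Icc z (z + t⁻¹)) = μ (Icc z (z + t⁻¹))) : ρ = μ := by
  have hex : ∀ n : ℕ, ∃ t ∈ Ioo (0 : ℝ) (1 / (n + 1)), ∀ᵐ z,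
      ρ (Icc z (z + t⁻¹)) = μ (Icc z (z + t⁻¹)) := by
    intro n
    have h' := ae_restrict_of_ae_restrict_of_subset
      (Ioo_subset_Ioi_self : Ioo (0 : ℝ) (1 / (n + 1)) ⊆ Ioi 0) h
    have hpos : (volume.restrict (Ioo (0 : ℝ) (1 / (n + 1)))) ≠ 0 := by
      rw [Ne, Measure.restrict_eq_zero, Real.volume_Ioo, ENNReal.ofReal_eq_zero, not_le]
      simp only [sub_zero]; positivity
    have : (ae (volume.restrict (Ioo (0 : ℝ) (1 / (n + 1))))).NeBot := ae_neBot.2 hpos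
    obtain ⟨t, ht1, ht2⟩ := (h'.and (ae_restrict_mem measurableSet_Ioo)).exists
    exact ⟨t, ht2, ht1⟩
  choose t ht hz using hex
  have hall : ∀ᵐ z : ℝ, ρ (Ici z) = μ (Ici z) := by
    have hlim : Tendsto (fun n => (t n)⁻¹) atTop atTop := by
      refine tendsto_atTop_mono (f := fun n : ℕ => (n : ℝ)) (fun n => ?_)
        tendsto_natCast_atTop_atTop
      have := (ht n).2.le
      rw [one_div] at this
      have h3 := inv_anti₀ (ht n).1 this
      rw [inv_inv] at h3
      linarith
    have hconv (ν : Measure ℝ) [IsProbabilityMeasure ν] (z : ℝ) :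
        Tendsto (fun n => ν (Icc z (z + (t n)⁻¹))) atTop (𝓝 (ν (Ici z))) := by
      have h0 : Tendsto (fun x => ν (Ici z ∩ Iic x)) atTop (𝓝 (ν (Ici z))) := by
        have := tendsto_measure_iUnion_atTop (μ := ν) (s := fun x : ℝ => Ici z ∩ Iic x)
          (fun a b hab => inter_subset_inter_right _ (Iic_subset_Iic.2 hab))
        rwa [← inter_iUnion, iUnion_Iic, inter_univ] at this
      exact h0.comp (tendsto_atTop_add_const_left _ z hlim)
    filter_upwards [ae_all_iff.2 hz] with z hz
    refine tendsto_nhds_unique (hconv ρ z) ?_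
    simp_rw [hz]
    exact hconv μ z
  refine Measure.ext_of_Ici _ _ fun a => ?_
  have hdense : ∀ n : ℕ, ∃ z ∈ Ioo (a - 1 / (n + 1)) a, ρ (Ici z) = μ (Ici z) := by
    intro n
    have hlt : a - 1 / ((n : ℝ) + 1) < a := sub_lt_self _ (by positivity)
    have hpos : (volume.restrict (Ioo (a - 1 / ((n : ℝ) + 1)) a)) ≠ 0 := by
      rw [Ne, Measure.restrict_eq_zero, Real.volume_Ioo, ENNReal.ofReal_eq_zero, not_le]
      linarith
    have : (ae (volume.restrict (Ioo (a - 1 / ((n : ℝ) + 1)) a))).NeBot := ae_neBot.2 hpos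
    obtain ⟨z, h1, h2⟩ := ((ae_restrict_of_ae (s := Ioo (a - 1 / ((n : ℝ) + 1)) a) hall).and
      (ae_restrict_mem measurableSet_Ioo)).exists
    exact ⟨z, h2, h1⟩
  choose z hz1 hz2 using hdense
  have hlim : Tendsto (fun n : ℕ => a - 1 / ((n : ℝ) + 1)) atTop (𝓝 a) := by
    simpa using tendsto_const_nhds.sub (tendsto_one_div_add_atTop_nhds_zero_nat (𝕜 := ℝ))
  have hconv (ν : Measure ℝ) [IsProbabilityMeasure ν] :
      Tendsto (fun n => ν (Ici (z n))) atTop (𝓝 (ν (Ici a))) := by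
    have hset : ⋂ n : ℕ, Ici (a - 1 / ((n : ℝ) + 1)) = Ici a := by
      ext y
      simp only [mem_iInter, mem_Ici]
      exact ⟨fun h => le_of_tendsto' hlim h, fun h n => (sub_le_self _ (by positivity)).trans h⟩
    have hup := tendsto_measure_iInter_atTop (μ := ν)
      (s := fun n : ℕ => Ici (a - 1 / ((n : ℝ) + 1)))
      (fun n => measurableSet_Ici.nullMeasurableSet)
      (fun m n hmn => Ici_subset_Ici.2 (sub_le_sub_left (Nat.one_div_le_one_div hmn) _))
      ⟨0, measure_ne_top _ _⟩
    rw [hset] at hup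
    exact tendsto_of_tendsto_of_tendsto_of_le_of_le tendsto_const_nhds hup
      (fun n => measure_mono (Ici_subset_Ici.2 (hz1 n).2.le))
      (fun n => measure_mono (Ici_subset_Ici.2 (hz1 n).1.le))
  refine tendsto_nhds_unique (hconv ρ) ?_
  simp_rw [hz2]
  exact hconv μ

/-- The mutual logarithmic energy of `ρ - μ` with itself is nonnegative, and vanishes only if
`ρ = μ`. -/
theorem log_energy_nonneg (ρ μ : Measure ℝ) [IsProbabilityMeasure ρ] [IsProbabilityMeasure μ]
    (dρ : ∀ᵐ p ∂ρ.prod ρ, p.1 ≠ p.2) (dμ : ∀ᵐ p ∂μ.prod μ, p.1 ≠ p.2)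
    (dρμ : ∀ᵐ p ∂ρ.prod μ, p.1 ≠ p.2)
    (iρ : Integrable (fun p => Real.log |p.1 - p.2|) (ρ.prod ρ))
    (iμ : Integrable (fun p => Real.log |p.1 - p.2|) (μ.prod μ))
    (iρμ : Integrable (fun p => Real.log |p.1 - p.2|) (ρ.prod μ)) :
    ∫ p, Real.log |p.1 - p.2| ∂ρ.prod ρ + ∫ p, Real.log |p.1 - p.2| ∂μ.prod μ ≤
      2 * ∫ p, Real.log |p.1 - p.2| ∂ρ.prod μ ∧
    (∫ p, Real.log |p.1 - p.2| ∂ρ.prod ρ + ∫ p, Real.log |p.1 - p.2| ∂μ.prod μ =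
      2 * ∫ p, Real.log |p.1 - p.2| ∂ρ.prod μ → ρ = μ) := by
  obtain ⟨j1, e1⟩ := log_integral_eq _ dρ iρ
  obtain ⟨j2, e2⟩ := log_integral_eq _ dμ iμ
  obtain ⟨j3, e3⟩ := log_integral_eq _ dρμ iρμ
  -- The terms `triangle t` cancel with weights `1 + 1 - 2 = 0`, and the factor `t` from the windows
  -- cancels `t⁻¹`, which leaves the integral of a square.
  set g : ℝ → ℝ := fun t => ∫ z, (ρ.real (Icc z (z + t⁻¹)) - μ.real (Icc z (z + t⁻¹))) ^ 2
  have hg0 : 0 ≤ g := fun t => integral_nonneg fun z => sq_nonneg _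
  have hcongr : ∀ t ∈ Ioi (0 : ℝ),
      t⁻¹ * (triangleMean (ρ.prod ρ) t - triangle t) +
      t⁻¹ * (triangleMean (μ.prod μ) t - triangle t) -
      2 * (t⁻¹ * (triangleMean (ρ.prod μ) t - triangle t)) = g t := by
    intro t (ht : 0 < t)
    have := (triangleMean_sub_sub ρ μ ht).2
    have h2 : t⁻¹ * (triangleMean (ρ.prod ρ) t - triangle t) +
      t⁻¹ * (triangleMean (μ.prod μ) t - triangle t) -
      2 * (t⁻¹ * (triangleMean (ρ.prod μ) t - triangle t)) = t⁻¹ * (triangleMean (ρ.prod ρ) t +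
        triangleMean (μ.prod μ) t - 2 * triangleMean (ρ.prod μ) t) := by ring
    rw [h2, this, inv_mul_cancel_left₀ ht.ne']
  have hgi : IntegrableOn g (Ioi 0) :=
    IntegrableOn.congr_fun ((j1.add j2).sub (j3.const_mul 2)) hcongr measurableSet_Ioi
  have hint : ∫ t in Ioi 0, g t = 2 * (∫ p, Real.log |p.1 - p.2| ∂ρ.prod μ) -
      (∫ p, Real.log |p.1 - p.2| ∂ρ.prod ρ + ∫ p, Real.log |p.1 - p.2| ∂μ.prod μ) := by
    rw [← setIntegral_congr_fun measurableSet_Ioi hcongr,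
      integral_sub (by exact j1.add j2) (j3.const_mul 2), integral_add j1 j2, integral_const_mul,
      e1, e2, e3]
    ring
  refine ⟨?_, fun heq => ?_⟩
  · have := integral_nonneg (μ := volume.restrict (Ioi (0 : ℝ))) hg0
    linarith
  · have h0 : ∫ t in Ioi 0, g t = 0 := by rw [hint, heq, sub_self]
    rw [integral_eq_zero_iff_of_nonneg hg0 hgi] at h0
    refine measure_eq_of_windows ρ μ ?_
    filter_upwards [h0, ae_restrict_mem measurableSet_Ioi] with t ht0 ht
    have h1 := (integral_eq_zero_iff_of_nonneg (fun z => sq_nonneg _)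
      (triangleMean_sub_sub ρ μ ht).1).1 ht0
    filter_upwards [h1] with z hz
    have : ρ.real (Icc z (z + t⁻¹)) = μ.real (Icc z (z + t⁻¹)) :=
      sub_eq_zero.1 (pow_eq_zero_iff two_ne_zero |>.1 hz)
    rwa [Measure.real, Measure.real, ENNReal.toReal_eq_toReal_iff' (measure_ne_top _ _)
      (measure_ne_top _ _)] at this

end LogEquilibrium

/-! ### Finite energies and the Euler-Lagrange criterion. -/

namespace LogEquilibrium

open MeasureTheory Set Filter Topology

section ExtIntegral

variable {X : Type*} [MeasurableSpace X] {τ : Measure X}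

lemma extIntegral_eq_integral {F : X → EReal} {k : X → ℝ} (hF : ∀ᵐ x ∂τ, F x = (k x : EReal))
    (hk : Integrable k τ) : extIntegral τ F = ((∫ x, k x ∂τ : ℝ) : EReal) := by
  have h1 : ∫⁻ x, (F x).toENNReal ∂τ = ∫⁻ x, ENNReal.ofReal (k x) ∂τ :=
    lintegral_congr_ae (hF.mono fun x hx => by simp [hx])
  have h2 : ∫⁻ x, (-F x).toENNReal ∂τ = ∫⁻ x, ENNReal.ofReal (-k x) ∂τ :=
    lintegral_congr_ae (hF.mono fun x hx => by
      simp only [hx]; rw [← EReal.coe_neg, EReal.real_coe_toENNReal])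
  have f1 : ∫⁻ x, ENNReal.ofReal (k x) ∂τ ≠ ⊤ := hk.lintegral_lt_top.ne
  have f2 : ∫⁻ x, ENNReal.ofReal (-k x) ∂τ ≠ ⊤ := hk.neg.lintegral_lt_top.ne
  rw [extIntegral, h1, h2, integral_eq_lintegral_pos_part_sub_lintegral_neg_part hk, EReal.coe_sub,
    EReal.coe_ennreal_toReal f1, EReal.coe_ennreal_toReal f2]

/-- The lower bound makes the negative part finite, so a value other than `⊤` forces the positive
part to be finite too; in particular the set where the function is `⊤` is null. -/
lemma integrable_of_extIntegral_ne_top [IsFiniteMeasure τ] {N : Set X} [DecidablePred (· ∈ N)]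
    (hN : MeasurableSet N)
    {k : X → ℝ} (hk : Measurable k) {C : ℝ} (hC : ∀ᵐ x ∂τ, -C ≤ k x)
    (hE : extIntegral τ (fun x => if x ∈ N then ⊤ else (k x : EReal)) ≠ ⊤) :
    τ N = 0 ∧ Integrable k τ := by
  set F : X → EReal := fun x => if x ∈ N then ⊤ else (k x : EReal)
  have hFm : Measurable F := Measurable.ite hN measurable_const hk.coe_real_ereal
  have hneg : ∫⁻ x, (-F x).toENNReal ∂τ ≠ ⊤ := by
    refine ((lintegral_mono_ae (g := fun _ => ENNReal.ofReal C) ?_).trans_lt ?_).ne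
    · filter_upwards [hC] with x hx
      by_cases h : x ∈ N
      · simp [F, h]
      · simp only [F, h, if_false]
        rw [← EReal.coe_neg, EReal.real_coe_toENNReal]
        exact ENNReal.ofReal_le_ofReal (by linarith)
    · rw [lintegral_const]
      exact ENNReal.mul_lt_top ENNReal.ofReal_lt_top (measure_lt_top _ _)
  have hpos : ∫⁻ x, (F x).toENNReal ∂τ ≠ ⊤ := by
    intro h
    refine hE ?_
    rw [extIntegral, h, EReal.coe_ennreal_top, ← EReal.coe_ennreal_toReal hneg,
      EReal.top_sub_coe]
  have hae : ∀ᵐ x ∂τ, x ∉ N := by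
    filter_upwards [ae_lt_top hFm.ereal_toENNReal hpos] with x hx hxN
    simp [F, hxN] at hx
  refine ⟨measure_eq_zero_iff_ae_notMem.2 hae, ?_⟩
  have h1 : Integrable (fun x => max (k x) 0) τ := by
    refine ⟨(hk.max measurable_const).aestronglyMeasurable, ?_⟩
    rw [hasFiniteIntegral_iff_ofReal (ae_of_all _ fun x =>
      show 0 ≤ max (k x) 0 from le_max_right _ _)]
    refine lt_of_eq_of_lt (lintegral_congr_ae ?_) hpos.lt_top
    filter_upwards [hae] with x hx
    simp [F, hx, ENNReal.ofReal_max]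
  refine Integrable.mono' (h1.add (integrable_const |C|)) hk.aestronglyMeasurable ?_
  filter_upwards [hC] with x hx
  rw [Real.norm_eq_abs, Pi.add_apply, abs_le]
  have := le_abs_self C
  have := le_max_left (k x) 0
  have := le_max_right (k x) 0
  exact ⟨by linarith, by linarith [abs_nonneg C]⟩

end ExtIntegral

/-- The external field `x ^ 2 + 2 α log (1 / x)` as a real function. -/
noncomputable def realField (α x : ℝ) : ℝ := x ^ 2 + 2 * α * Real.log (1 / x)

lemma measurable_realField (α : ℝ) : Measurable (realField α) := by
  unfold realField
  exact (measurable_id.pow_const 2).add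
    (measurable_const.mul (Real.measurable_log.comp (measurable_const.div measurable_id)))

/-- From `log x ≤ x`, the field is at least `x² - 2 α x`; complete the square. -/
lemma realField_lower {α x : ℝ} (hα : 0 ≤ α) (hx : 0 < α → 0 ≤ x) :
    x ^ 2 / 2 - 2 * α ^ 2 ≤ realField α x := by
  rcases hα.eq_or_lt with rfl | h
  · simp only [realField]; nlinarith [sq_nonneg x]
  · have h1 := Real.log_le_self (hx h)
    rw [realField, one_div, Real.log_inv]
    nlinarith [sq_nonneg (x - 2 * α)]

/-- The set of pairs where the energy kernel is infinite. -/
def singularSet (α : ℝ) : Set (ℝ × ℝ) :=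
  {p | p.1 = p.2 ∨ (0 < α ∧ (p.1 = 0 ∨ p.2 = 0))}

lemma measurableSet_singularSet (α : ℝ) : MeasurableSet (singularSet α) := by
  have h1 : MeasurableSet {p : ℝ × ℝ | p.1 = p.2} :=
    (isClosed_eq continuous_fst continuous_snd).measurableSet
  have h2 : MeasurableSet {p : ℝ × ℝ | p.1 = 0} :=
    (isClosed_eq continuous_fst continuous_const).measurableSet
  have h3 : MeasurableSet {p : ℝ × ℝ | p.2 = 0} :=
    (isClosed_eq continuous_snd continuous_const).measurableSet
  exact h1.union ((MeasurableSet.const (0 < α)).inter (h2.union h3))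

/-- The energy kernel off the singular set. -/
noncomputable def realKernel (α : ℝ) (p : ℝ × ℝ) : ℝ :=
  -Real.log |p.1 - p.2| + (realField α p.1 + realField α p.2) / 2

lemma measurable_log_dist : Measurable fun p : ℝ × ℝ => Real.log |p.1 - p.2| :=
  Real.measurable_log.comp (by fun_prop)

lemma measurable_realKernel (α : ℝ) : Measurable (realKernel α) := by
  unfold realKernel
  have := measurable_realField α
  exact measurable_log_dist.neg.add
    (((this.comp measurable_fst).add (this.comp measurable_snd)).div_const 2)

open Classical in
lemma energy_eq_extIntegral (α : ℝ) (ρ : Measure ℝ) :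
    energy (extField α) ρ = extIntegral (ρ.prod ρ)
      (fun p => if p ∈ singularSet α then ⊤ else (realKernel α p : EReal)) := by
  rw [energy]
  congr 1
  ext p
  have hhalf : (0 : EReal) < ((1 / 2 : ℝ) : EReal) := by exact_mod_cast one_half_pos
  have htop : ((1 / 2 : ℝ) : EReal) * ⊤ = ⊤ := EReal.coe_mul_top_of_pos one_half_pos
  have hfield : ∀ x, ¬(0 < α ∧ x = 0) → extField α x = ((realField α x : ℝ) : EReal) :=
    fun x h => by rw [extField, if_neg h, realField]
  have hbot : ∀ x, ((1 / 2 : ℝ) : EReal) * extField α x ≠ ⊥ := fun x => by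
    by_cases h : 0 < α ∧ x = 0
    · rw [extField, if_pos h, htop]; exact top_ne_bot
    · rw [hfield x h, ← EReal.coe_mul]; exact EReal.coe_ne_bot _
  have hbot' : logKernel p.1 p.2 ≠ ⊥ := by
    rw [logKernel]; split_ifs
    · exact top_ne_bot
    · exact EReal.coe_ne_bot _
  split_ifs with h
  · rcases h with h | ⟨h0, h | h⟩
    · rw [logKernel, if_pos h, EReal.top_add_of_ne_bot]
      exact EReal.add_ne_bot_iff.2 ⟨hbot _, hbot _⟩
    · rw [show extField α p.1 = ⊤ from if_pos ⟨h0, h⟩, htop, EReal.top_add_of_ne_bot (hbot _),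
        EReal.add_top_of_ne_bot hbot']
    · rw [show extField α p.2 = ⊤ from if_pos ⟨h0, h⟩, htop, EReal.add_top_of_ne_bot (hbot _),
        EReal.add_top_of_ne_bot hbot']
  · simp only [singularSet, mem_ofPred_eq, not_or, not_and] at h
    rw [hfield _ (fun h' => (h.2 h'.1).1 h'.2), hfield _ (fun h' => (h.2 h'.1).2 h'.2), logKernel,
      if_neg h.1]
    rw [← EReal.coe_mul, ← EReal.coe_mul, ← EReal.coe_add, ← EReal.coe_add, realKernel, one_div,
      Real.log_inv]
    congr 1; ring

/-- Half of the field terms absorbs `log |x - y| ≤ |x| + |y|`. The other half is kept, so that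
integrability of the kernel passes to the field. -/
lemma realKernel_lower {α x y : ℝ} (hα : 0 ≤ α) (hx : 0 < α → 0 ≤ x) (hy : 0 < α → 0 ≤ y) :
    (realField α x + realField α y) / 4 - (4 + α ^ 2) ≤ realKernel α (x, y) := by
  have h1 := realField_lower hα hx
  have h2 := realField_lower hα hy
  have h3 := Real.log_le_self (abs_nonneg (x - y))
  have h4 := abs_sub x y
  simp only [realKernel]
  nlinarith [sq_nonneg (|x| - 4), sq_nonneg (|y| - 4), sq_abs x, sq_abs y]

/-- Bounds the integral of `|log |x - y||` by first moments and the potential itself. -/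
lemma abs_log_le {u : ℝ} (hu : 0 ≤ u) : |Real.log u| ≤ 2 * u - Real.log u := by
  have := Real.log_le_self hu
  rw [abs_le]; constructor <;> linarith

lemma ae_prod_ne (ρ μ : Measure ℝ) [SFinite ρ] [SFinite μ] [NullSingletonClass μ] :
    ∀ᵐ p ∂ρ.prod μ, p.1 ≠ p.2 := by
  have hm : MeasurableSet {p : ℝ × ℝ | p.1 ≠ p.2} :=
    (isOpen_ne_fun continuous_fst continuous_snd).measurableSet
  rw [Measure.ae_prod_iff_ae_ae hm]
  refine ae_of_all _ fun x => ?_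
  filter_upwards [measure_eq_zero_iff_ae_notMem.1 (measure_singleton (μ := μ) x)] with y hy h
  exact hy h.symm

variable {α : ℝ} {S : Set ℝ} {ρ : Measure ℝ}

lemma integrable_abs_of_integrable_realField [IsProbabilityMeasure ρ] (hα : 0 ≤ α)
    (hS0 : 0 < α → S ⊆ Ici 0) (hρS : ∀ᵐ x ∂ρ, x ∈ S) (hq : Integrable (realField α) ρ) :
    Integrable (fun x => |x|) ρ := by
  refine Integrable.mono' ((hq.const_mul 2).add (integrable_const (4 * α ^ 2 + 1)))
    (by fun_prop) ?_
  filter_upwards [hρS] with x hx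
  have := realField_lower hα (fun h => hS0 h hx)
  simp only [norm_abs_eq_norm, Real.norm_eq_abs, Pi.add_apply]
  nlinarith [sq_nonneg (|x| - 1), sq_abs x]

/-- A finite energy makes each of its parts integrable. -/
lemma finite_energy [IsProbabilityMeasure ρ] (hα : 0 ≤ α)
    (hS0 : 0 < α → S ⊆ Ici 0) (hρS : ∀ᵐ x ∂ρ, x ∈ S) (hE : energy (extField α) ρ ≠ ⊤) :
    (∀ᵐ p ∂ρ.prod ρ, p ∉ singularSet α) ∧ Integrable (realField α) ρ ∧
      Integrable (fun p => Real.log |p.1 - p.2|) (ρ.prod ρ) := by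
  classical
  rw [energy_eq_extIntegral] at hE
  have hSS : ∀ᵐ p ∂ρ.prod ρ, p.1 ∈ S ∧ p.2 ∈ S :=
    (Measure.quasiMeasurePreserving_fst.ae hρS).and (Measure.quasiMeasurePreserving_snd.ae hρS)
  have hq := measurable_realField α
  have hlow : ∀ᵐ p ∂ρ.prod ρ, -(4 + 2 * α ^ 2) ≤ realKernel α p := by
    filter_upwards [hSS] with p hp
    have h1 := realKernel_lower hα (fun h => hS0 h hp.1) (fun h => hS0 h hp.2)
    have h2 := realField_lower hα (fun h => hS0 h hp.1)
    have h3 := realField_lower hα (fun h => hS0 h hp.2)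
    nlinarith [sq_nonneg p.1, sq_nonneg p.2]
  obtain ⟨hN, hk⟩ := integrable_of_extIntegral_ne_top (measurableSet_singularSet α)
    (measurable_realKernel α) hlow hE
  have hqq : Integrable (fun p : ℝ × ℝ => realField α p.1 + realField α p.2) (ρ.prod ρ) := by
    refine Integrable.mono' ((hk.abs.const_mul 4).add (integrable_const (16 + 8 * α ^ 2)))
      ((hq.comp measurable_fst).add (hq.comp measurable_snd)).aestronglyMeasurable ?_
    filter_upwards [hSS] with p hp
    have h1 := realKernel_lower hα (fun h => hS0 h hp.1) (fun h => hS0 h hp.2)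
    have h2 := realField_lower hα (fun h => hS0 h hp.1)
    have h3 := realField_lower hα (fun h => hS0 h hp.2)
    have h4 := le_abs_self (realKernel α p)
    have h5 := abs_nonneg (realKernel α p)
    rw [Real.norm_eq_abs, Pi.add_apply, abs_le]
    constructor
    · nlinarith [sq_nonneg p.1, sq_nonneg p.2, sq_nonneg α]
    · nlinarith [sq_nonneg α]
  refine ⟨measure_eq_zero_iff_ae_notMem.1 hN, ?_, ?_⟩
  -- Almost every section of the integrable sum is integrable; on one section the first term is a
  -- constant.
  · obtain ⟨x, hx⟩ := hqq.prod_right_ae.exists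
    refine (hx.sub (integrable_const (realField α x))).congr (ae_of_all _ fun y => ?_)
    simp
  · have := (hqq.div_const 2).sub hk
    refine this.congr (ae_of_all _ fun p => ?_)
    simp only [realKernel, Pi.sub_apply]; ring

lemma energy_eq_integral [IsProbabilityMeasure ρ]
    (hN : ∀ᵐ p ∂ρ.prod ρ, p ∉ singularSet α) (hq : Integrable (realField α) ρ)
    (hl : Integrable (fun p => Real.log |p.1 - p.2|) (ρ.prod ρ)) :
    energy (extField α) ρ = ((∫ x, realField α x ∂ρ - ∫ p, Real.log |p.1 - p.2| ∂ρ.prod ρ : ℝ) :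
      EReal) := by
  classical
  have i1 : Integrable (fun p : ℝ × ℝ => realField α p.1) (ρ.prod ρ) := hq.comp_fst ρ
  have i2 : Integrable (fun p : ℝ × ℝ => realField α p.2) (ρ.prod ρ) := hq.comp_snd ρ
  rw [energy_eq_extIntegral, extIntegral_eq_integral (k := realKernel α)
    (hN.mono fun p hp => if_neg hp)]
  · congr 1
    simp only [realKernel]
    have e1 : ∫ p : ℝ × ℝ, realField α p.1 ∂ρ.prod ρ = ∫ x, realField α x ∂ρ := by
      rw [integral_fun_fst]; simp
    have e2 : ∫ p : ℝ × ℝ, realField α p.2 ∂ρ.prod ρ = ∫ x, realField α x ∂ρ := by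
      rw [integral_fun_snd]; simp
    rw [integral_add (by exact hl.neg) (by exact (i1.add i2).div_const 2), integral_neg,
      integral_div, integral_add i1 i2, e1, e2]
    ring
  · exact hl.neg.add ((i1.add i2).div_const 2)

/-- A measure whose potential satisfies the Euler-Lagrange conditions is the equilibrium
measure. -/
theorem isEquilibriumMeasure_of_variational (hα : 0 ≤ α)
    (hS0 : 0 < α → S ⊆ Ici 0) {μ : Measure ℝ} [IsProbabilityMeasure μ]
    [NullSingletonClass μ]
    (hμS : μ Sᶜ = 0) (hq : Integrable (realField α) μ)
    (hlog : ∀ x ∈ S, Integrable (fun y => Real.log |x - y|) μ)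
    {C c : ℝ} (hlow : ∀ x ∈ S, C ≤ ∫ y, Real.log |x - y| ∂μ)
    (hge : ∀ x ∈ S, (0 < α → x ≠ 0) → c ≤ realField α x / 2 - ∫ y, Real.log |x - y| ∂μ)
    (heq : ∀ᵐ x ∂μ, realField α x / 2 - ∫ y, Real.log |x - y| ∂μ = c) :
    IsEquilibriumMeasure (extField α) S μ := by
  set V : ℝ → ℝ := fun x => ∫ y, Real.log |x - y| ∂μ with hV
  have hVm : StronglyMeasurable V := by
    have : StronglyMeasurable fun p : ℝ × ℝ => Real.log |p.1 - p.2| :=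
      measurable_log_dist.stronglyMeasurable
    exact this.integral_prod_right
  have hμS' : ∀ᵐ x ∂μ, x ∈ S := by
    filter_upwards [measure_eq_zero_iff_ae_notMem.1 hμS] with x hx using not_not.1 hx
  have habsμ := integrable_abs_of_integrable_realField hα hS0 hμS' hq
  -- The mixed energy is finite: the potential `V` lies between `C` and half the field minus `c`,
  -- hence is `ν`-integrable, and `abs_log_le` then gives integrability of the logarithm on the
  -- product.
  have mixed : ∀ ν : Measure ℝ, IsProbabilityMeasure ν → (∀ᵐ x ∂ν, x ∈ S) →
      (0 < α → ν {0} = 0) → Integrable (realField α) ν →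
      Integrable V ν ∧ Integrable (fun p => Real.log |p.1 - p.2|) (ν.prod μ) ∧
      ∫ p, Real.log |p.1 - p.2| ∂ν.prod μ = ∫ x, V x ∂ν := by
    intro ν _ hνS hν0 hqν
    have hne : ∀ᵐ x ∂ν, 0 < α → x ≠ 0 := by
      by_cases h : 0 < α
      · filter_upwards [measure_eq_zero_iff_ae_notMem.1 (hν0 h)] with x hx _ using hx
      · exact ae_of_all _ fun x hx => absurd hx h
    have hVi : Integrable V ν := by
      refine Integrable.mono' ((hqν.abs).add (integrable_const (|C| + |c|)))
        hVm.aestronglyMeasurable ?_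
      filter_upwards [hνS, hne] with x hx hx0
      have h1 : C ≤ V x := hlow x hx
      have h2 : c ≤ realField α x / 2 - V x := hge x hx hx0
      rw [Real.norm_eq_abs, Pi.add_apply, abs_le]
      have h3 := le_abs_self (realField α x)
      have h4 := neg_abs_le C
      have h5 := neg_abs_le c
      have h6 := abs_nonneg (realField α x)
      have h7 := abs_nonneg C
      have h8 := abs_nonneg c
      constructor <;> linarith
    have hli : Integrable (fun p => Real.log |p.1 - p.2|) (ν.prod μ) := by
      rw [integrable_prod_iff measurable_log_dist.aestronglyMeasurable]
      refine ⟨hνS.mono hlog, ?_⟩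
      have habsν := integrable_abs_of_integrable_realField hα hS0 hνS hqν
      refine Integrable.mono' (((habsν.const_mul 2).add
        (integrable_const (2 * ∫ y, |y| ∂μ))).sub hVi) ?_ ?_
      · have : StronglyMeasurable fun p : ℝ × ℝ => ‖Real.log |p.1 - p.2|‖ :=
          measurable_log_dist.norm.stronglyMeasurable
        exact this.integral_prod_right.aestronglyMeasurable
      · filter_upwards [hνS] with x hx
        rw [Real.norm_eq_abs, abs_of_nonneg (integral_nonneg fun y => norm_nonneg _)]
        have i1 : Integrable (fun y => 2 * |x| + 2 * |y|) μ :=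
          (integrable_const _).add (habsμ.const_mul 2)
        calc ∫ y, ‖Real.log |x - y|‖ ∂μ
            ≤ ∫ y, ((2 * |x| + 2 * |y|) - Real.log |x - y|) ∂μ := by
              refine integral_mono (hlog x hx).norm (i1.sub (hlog x hx)) fun y => ?_
              have h1 := abs_log_le (abs_nonneg (x - y))
              have h2 := abs_sub x y
              simp only [Real.norm_eq_abs]
              linarith
          _ = _ := by
              rw [integral_sub i1 (hlog x hx), integral_add (integrable_const _)
                (habsμ.const_mul 2), integral_const_mul]
              rw [integral_const_mul]
              simp [V]
    exact ⟨hVi, hli, integral_prod _ hli⟩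
  obtain ⟨hVμ, hlμ, eμ⟩ := mixed μ inferInstance hμS' (fun _ => measure_singleton 0) hq
  have hNμ : ∀ᵐ p ∂μ.prod μ, p ∉ singularSet α := by
    have hz : ∀ᵐ x ∂μ, x ≠ 0 := measure_eq_zero_iff_ae_notMem.1 (measure_singleton (μ := μ) 0)
    filter_upwards [ae_prod_ne μ μ, Measure.quasiMeasurePreserving_fst.ae hz,
      Measure.quasiMeasurePreserving_snd.ae hz] with p h1 h2 h3
    rintro (h | ⟨-, h | h⟩)
    exacts [h1 h, h2 h, h3 h]
  have hEμ := energy_eq_integral hNμ hq hlμ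
  have hμ0 : (∫ x, realField α x ∂μ) / 2 - ∫ x, V x ∂μ = c := by
    rw [← integral_div, ← integral_sub (hq.div_const 2) hVμ, integral_congr_ae heq]
    simp
  have key : ∀ ν ∈ probMeasuresOn S, energy (extField α) ν ≠ ⊤ →
      energy (extField α) μ ≤ energy (extField α) ν ∧
      (energy (extField α) ν = energy (extField α) μ → ν = μ) := by
    rintro ν ⟨hν, hνS⟩ hE
    have hνS' : ∀ᵐ x ∂ν, x ∈ S := by
      filter_upwards [measure_eq_zero_iff_ae_notMem.1 hνS] with x hx using not_not.1 hx
    obtain ⟨hN, hqν, hlν⟩ := finite_energy hα hS0 hνS' hE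
    have hν0 : 0 < α → ν {0} = 0 := by
      intro h
      have h1 : ∀ᵐ x ∂ν, ∀ᵐ y ∂ν, (x, y) ∉ singularSet α := Measure.ae_ae_of_ae_prod hN
      refine measure_eq_zero_iff_ae_notMem.2 (h1.mono fun x hx hx0 => ?_)
      obtain ⟨y, hy⟩ := hx.exists
      exact hy (Or.inr ⟨h, Or.inl hx0⟩)
    obtain ⟨hVν, hlm, em⟩ := mixed ν hν hνS' hν0 hqν
    have hne : ∀ᵐ x ∂ν, 0 < α → x ≠ 0 := by
      by_cases h : 0 < α
      · filter_upwards [measure_eq_zero_iff_ae_notMem.1 (hν0 h)] with x hx _ using hx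
      · exact ae_of_all _ fun x hx => absurd hx h
    have hνc : c ≤ (∫ x, realField α x ∂ν) / 2 - ∫ x, V x ∂ν := by
      rw [← integral_div, ← integral_sub (hqν.div_const 2) hVν]
      calc c = ∫ _, c ∂ν := by simp
        _ ≤ _ := by
          refine integral_mono_ae (integrable_const _) ((hqν.div_const 2).sub hVν) ?_
          filter_upwards [hνS', hne] with x hx hx0 using hge x hx hx0
    -- Write `L` for the integral of `log |x - y|`. Positivity gives `E(ν) ≥ ∫ Q dν - 2 L(ν, μ) +
    -- L(μ, μ)`, which is at least `2 c + L(μ, μ) = E(μ)`. Equality of the extreme terms forces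
    -- equality in positivity, hence `ν = μ`.
    have hpos := log_energy_nonneg ν μ (hN.mono fun p hp h => hp (Or.inl h)) (ae_prod_ne μ μ)
      (ae_prod_ne ν μ) hlν hlμ hlm
    rw [energy_eq_integral hN hqν hlν, hEμ]
    rw [em, eμ] at hpos
    rw [eμ]
    refine ⟨EReal.coe_le_coe_iff.2 (by linarith [hpos.1]), fun h => hpos.2 ?_⟩
    have h' := EReal.coe_eq_coe_iff.1 h
    linarith [hpos.1]
  have hμmem : μ ∈ probMeasuresOn S := ⟨inferInstance, hμS⟩
  have hmin : energy (extField α) μ = minEnergy (extField α) S := by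
    refine le_antisymm (le_iInf₂ fun ν hν => ?_) (iInf₂_le μ hμmem)
    by_cases h : energy (extField α) ν = ⊤
    · rw [h]; exact le_top
    · exact (key ν hν h).1
  refine ⟨hμmem, hmin, fun ν hν h => ?_⟩
  rw [← hmin] at h
  exact (key ν hν (by rw [h, hEμ]; exact EReal.coe_ne_top _)).2 h

end LogEquilibrium

/-! ### Logarithmic potentials of weights on the unit circle. -/

namespace LogEquilibrium

open MeasureTheory Set Filter Topology Complex Metric
open Real (circleAverage)

lemma cos_nat_mul_eq (n : ℕ) (θ : ℝ) :
    ((Real.cos (n * θ) : ℝ) : ℂ) =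
      ((circleMap 0 1 θ) ^ n + ((circleMap 0 1 θ) ^ n)⁻¹) / 2 := by
  have h : circleMap 0 1 θ ^ n = exp ((n * θ : ℂ) * I) := by
    rw [circleMap_zero, ofReal_one, one_mul, ← Complex.exp_nat_mul]; ring_nf
  rw [h, ← Complex.exp_neg]
  push_cast
  rw [Complex.cos, neg_mul]

/-- Cauchy's formula for the real part of a holomorphic function on the disc. -/
lemma integral_cos_mul_re {f : ℂ → ℂ} (hf : DifferentiableOn ℂ f (closedBall 0 1)) {n : ℕ}
    (hn : n ≠ 0) :
    ∫ θ in 0..2 * Real.pi, Real.cos (n * θ) * (f (circleMap 0 1 θ)).re =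
      Real.pi * (iteratedDeriv n f 0 / n.factorial).re := by
  have hcl : DiffContOnCl ℂ f (ball 0 1) :=
    (hf.mono closure_ball_subset_closedBall).diffContOnCl
  have hcont : ContinuousOn f (sphere 0 1) := hf.continuousOn.mono sphere_subset_closedBall
  have h0 : circleAverage (fun ζ => ζ ^ n * f ζ) 0 1 = 0 := by
    have hd : DiffContOnCl ℂ (fun ζ => ζ ^ n * f ζ) (ball 0 |1|) := by
      rw [abs_one]
      exact (((differentiable_id.pow n).differentiableOn.mul
        (hf.mono closure_ball_subset_closedBall))).diffContOnCl
    rw [hd.circleAverage]; simp [hn]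
  have h1 : circleAverage (fun ζ => (ζ ^ n)⁻¹ * f ζ) 0 1 = iteratedDeriv n f 0 / n.factorial := by
    rw [Real.circleAverage_eq_circleIntegral one_ne_zero]
    have := hcl.circleIntegral_one_div_sub_center_pow_smul one_pos n
    have hcg : (∮ z in C(0, 1), (z - 0)⁻¹ • ((z ^ n)⁻¹ * f z)) =
        ∮ z in C(0, 1), (1 / (z - 0) ^ (n + 1)) • f z := by
      refine circleIntegral.integral_congr zero_le_one fun z hz => ?_
      simp only [sub_zero, smul_eq_mul, pow_succ, one_div, mul_inv]
      ring
    rw [hcg, this, smul_eq_mul, smul_eq_mul]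
    have : (2 * Real.pi * I : ℂ) ≠ 0 := by
      simp [Real.pi_ne_zero]
    field_simp
  have hi0 : CircleIntegrable (fun ζ => ζ ^ n * f ζ) 0 1 :=
    ContinuousOn.circleIntegrable zero_le_one ((continuous_id.pow n).continuousOn.mul hcont)
  have hi1 : CircleIntegrable (fun ζ => (ζ ^ n)⁻¹ * f ζ) 0 1 := by
    refine ContinuousOn.circleIntegrable zero_le_one
      (ContinuousOn.mul (ContinuousOn.inv₀ (by fun_prop) fun z hz => ?_) hcont)
    exact pow_ne_zero _ (ne_zero_of_mem_unit_sphere (⟨z, hz⟩ : sphere (0 : ℂ) 1))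
  have hsum := Real.circleAverage_fun_add hi0 hi1
  rw [h0, h1, zero_add] at hsum
  -- On the circle `ζ ^ n + ζ ^ (-n)` is the real number `2 cos (n θ)`, so the real part of the sum
  -- of the two averages is the cosine moment of `re f`.
  have hre := Complex.reCLM.circleAverage_comp_comm (hi0.add hi1)
  have hF : ∀ θ : ℝ, (reCLM ∘ ((fun ζ => ζ ^ n * f ζ) + fun ζ => (ζ ^ n)⁻¹ * f ζ))
      (circleMap 0 1 θ) = 2 * (Real.cos (n * θ) * (f (circleMap 0 1 θ)).re) := by
    intro θ
    rw [Function.comp_apply, reCLM_apply, ← mul_assoc, ← re_ofReal_mul, ofReal_mul,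
      cos_nat_mul_eq, Pi.add_apply]
    congr 1; push_cast; ring
  rw [Real.circleAverage_def] at hre
  simp_rw [hF] at hre
  rw [intervalIntegral.integral_const_mul, smul_eq_mul,
    inv_mul_eq_iff_eq_mul₀ (by positivity)] at hre
  have h2 : circleAverage ((fun ζ => ζ ^ n * f ζ) + fun ζ => (ζ ^ n)⁻¹ * f ζ) 0 1 =
    iteratedDeriv n f 0 / n.factorial := hsum
  rw [h2, reCLM_apply] at hre
  linarith

lemma one_sub_div_mem_slitPlane {z ζ : ℂ} (hz : 1 < ‖z‖) (hζ : ‖ζ‖ ≤ 1) :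
    1 - ζ / z ∈ slitPlane := by
  refine Or.inl ?_
  have h : ‖ζ / z‖ < 1 := by
    rw [norm_div, div_lt_one (by linarith)]; linarith
  have := (abs_le.1 (abs_re_le_norm (ζ / z))).2
  rw [sub_re, one_re]; linarith

lemma log_norm_sub_eq {z ζ : ℂ} (hz : 1 < ‖z‖) (hζ : ‖ζ‖ ≤ 1) :
    Real.log ‖ζ - z‖ = Real.log ‖z‖ + (log (1 - ζ / z)).re := by
  have hz0 : z ≠ 0 := norm_pos_iff.1 (by linarith)
  have h1 : 1 - ζ / z ≠ 0 := slitPlane_ne_zero (one_sub_div_mem_slitPlane hz hζ)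
  rw [log_re, ← Real.log_mul (norm_ne_zero_iff.2 hz0) (norm_ne_zero_iff.2 h1), ← norm_mul,
    mul_sub, mul_one, mul_div_cancel₀ _ hz0, norm_sub_rev]

/-- For `‖z‖ > 1`, `log ‖ζ - z‖` is a constant plus the real part of the holomorphic `log (1 - ζ /
z)`, and the constant has no cosine moment of order `n ≠ 0`. -/
lemma integral_cos_mul_log_norm {z : ℂ} (hz : 1 < ‖z‖) {n : ℕ} (hn : n ≠ 0) :
    ∫ θ in 0..2 * Real.pi, Real.cos (n * θ) * Real.log ‖circleMap 0 1 θ - z‖ =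
      Real.pi * (iteratedDeriv n (fun ζ => log (1 - ζ / z)) 0 / n.factorial).re := by
  have hf : DifferentiableOn ℂ (fun ζ => log (1 - ζ / z)) (closedBall 0 1) := fun ζ hζ =>
    (DifferentiableAt.clog (f := fun ζ => 1 - ζ / z) (by fun_prop) (one_sub_div_mem_slitPlane hz
      (by simpa using hζ))).differentiableWithinAt
  rw [← integral_cos_mul_re hf hn]
  have hcos : ∫ θ in 0..2 * Real.pi, Real.cos (n * θ) = 0 := by
    rw [intervalIntegral.integral_comp_mul_left (fun x => Real.cos x) (by exact_mod_cast hn)]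
    have := Real.sin_nat_mul_two_pi_sub 0 n
    rw [sub_zero, Real.sin_zero, neg_zero] at this
    simp [integral_cos, this]
  have hrw : ∀ θ : ℝ, Real.cos (n * θ) * Real.log ‖circleMap 0 1 θ - z‖ =
      Real.cos (n * θ) * Real.log ‖z‖ +
        Real.cos (n * θ) * (log (1 - circleMap 0 1 θ / z)).re := fun θ => by
    rw [log_norm_sub_eq hz (by simp), mul_add]
  simp_rw [hrw]
  rw [intervalIntegral.integral_add, intervalIntegral.integral_mul_const, hcos, zero_mul, zero_add]
  · exact (by fun_prop : Continuous _).intervalIntegrable _ _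
  · refine Continuous.intervalIntegrable ?_ _ _
    refine Continuous.mul (by fun_prop) (continuous_re.comp ?_)
    refine Continuous.clog (by fun_prop) fun θ => one_sub_div_mem_slitPlane hz (by simp)

lemma deriv_log_one_sub_div {z ζ : ℂ} (hz : 1 < ‖z‖) (hζ : ‖ζ‖ ≤ 1) :
    HasDerivAt (fun ζ => log (1 - ζ / z)) (ζ - z)⁻¹ ζ := by
  have hz0 : z ≠ 0 := norm_pos_iff.1 (by linarith)
  have h1 := one_sub_div_mem_slitPlane hz hζ
  have h2 : HasDerivAt (fun ζ : ℂ => 1 - ζ / z) (-(1 / z)) ζ :=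
    ((hasDerivAt_id ζ).div_const z).const_sub 1
  convert h2.clog h1 using 1
  have h3 := slitPlane_ne_zero h1
  have h4 : ζ - z ≠ 0 := by
    rintro h; rw [sub_eq_zero] at h; rw [h] at hζ; linarith
  have h5 : z - ζ ≠ 0 := by rwa [← neg_ne_zero, neg_sub]
  rw [inv_eq_one_div, div_eq_div_iff h4 h3]
  field_simp
  ring

lemma integral_cos_one {z : ℂ} (hz : 1 < ‖z‖) :
    ∫ θ in 0..2 * Real.pi, Real.cos θ * Real.log ‖circleMap 0 1 θ - z‖ =
      -Real.pi * (z⁻¹).re := by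
  have := integral_cos_mul_log_norm hz one_ne_zero
  simp only [Nat.cast_one, one_mul] at this
  rw [this, iteratedDeriv_one, (deriv_log_one_sub_div hz (by simp)).deriv]
  simp

lemma integral_cos_two {z : ℂ} (hz : 1 < ‖z‖) :
    ∫ θ in 0..2 * Real.pi, Real.cos (2 * θ) * Real.log ‖circleMap 0 1 θ - z‖ =
      -Real.pi / 2 * ((z ^ 2)⁻¹).re := by
  have hz0 : z ≠ 0 := norm_pos_iff.1 (by linarith)
  have := integral_cos_mul_log_norm hz two_ne_zero
  simp only [Nat.cast_ofNat] at this
  have hd : deriv (fun ζ => log (1 - ζ / z)) =ᶠ[𝓝 0] fun ζ => (ζ - z)⁻¹ := by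
    filter_upwards [ball_mem_nhds (0 : ℂ) one_pos] with ζ hζ
    exact (deriv_log_one_sub_div hz (mem_ball_zero_iff.1 hζ).le).deriv
  have hd2 : HasDerivAt (fun ζ : ℂ => (ζ - z)⁻¹) (-1 / (0 - z) ^ 2) 0 :=
    ((hasDerivAt_id (0 : ℂ)).sub_const z).inv (by simpa using hz0)
  rw [this, iteratedDeriv_succ, iteratedDeriv_one, hd.deriv_eq, hd2.deriv]
  have : (-1 / (0 - z) ^ 2 / ((2 : ℕ).factorial : ℂ)) = ((-1 / 2 : ℝ) : ℂ) * (z ^ 2)⁻¹ := by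
    push_cast
    simp
    field_simp
  rw [this, re_ofReal_mul]
  ring

/-- The weight is the Poisson kernel of the point `-r`, and `log ‖ζ - z‖` is harmonic on the closed
disc, so the average is its value at `-r`. -/
lemma integral_poisson {z : ℂ} (hz : 1 < ‖z‖) {r : ℝ} (hr0 : 0 ≤ r) (hr1 : r < 1) :
    ∫ θ in 0..2 * Real.pi, (1 - r ^ 2) / (1 + r ^ 2 + 2 * r * Real.cos θ) *
      Real.log ‖circleMap 0 1 θ - z‖ = 2 * Real.pi * (Real.log ‖z‖ + Real.log ‖1 + r / z‖) := by
  have hz0 : z ≠ 0 := norm_pos_iff.1 (by linarith)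
  have hharm : InnerProductSpace.HarmonicOnNhd (fun ζ : ℂ => Real.log ‖ζ - z‖)
      (closedBall 0 1) := by
    intro x hx
    apply AnalyticAt.harmonicAt_log_norm (by fun_prop)
    rw [sub_ne_zero]
    rintro rfl
    simp at hx; linarith
  have hw : (-r : ℂ) ∈ ball (0 : ℂ) 1 := by simp [abs_of_nonneg hr0, hr1]
  have h := hharm.circleAverage_poissonKernel_smul hw
  rw [Real.circleAverage_def, smul_eq_mul, inv_mul_eq_iff_eq_mul₀ (by positivity)] at h
  have hcg : ∀ θ : ℝ, (poissonKernel 0 (-r : ℂ) • fun ζ : ℂ => Real.log ‖ζ - z‖)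
      (circleMap 0 1 θ) = (1 - r ^ 2) / (1 + r ^ 2 + 2 * r * Real.cos θ) *
      Real.log ‖circleMap 0 1 θ - z‖ := by
    intro θ
    rw [Pi.smul_apply', smul_eq_mul, poissonKernel_def]
    congr 2
    · simp
    · rw [← normSq_eq_norm_sq, normSq_apply]
      simp [circleMap]
      nlinarith [Real.sin_sq_add_cos_sq θ]
  simp_rw [hcg] at h
  rw [h, ← Real.log_mul (norm_ne_zero_iff.2 hz0), ← norm_mul, mul_add, mul_one,
    mul_div_cancel₀ _ hz0, ← norm_neg]
  · congr 3; ring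
  · rw [norm_ne_zero_iff]
    intro h0
    have h1 : z = -r := by field_simp at h0; linear_combination h0
    rw [h1] at hz; simp [abs_of_nonneg hr0] at hz; linarith

/-- The density of a measure on the circle whose logarithmic potential is elementary. -/
noncomputable def angleWeight (c₁ c₂ d r θ : ℝ) : ℝ :=
  1 + c₁ * Real.cos θ + c₂ * Real.cos (2 * θ) +
    d * ((1 - r ^ 2) / (1 + r ^ 2 + 2 * r * Real.cos θ) - 1)

lemma poisson_denom_pos {r : ℝ} (hr0 : 0 ≤ r) (hr1 : r < 1) (θ : ℝ) :
    0 < 1 + r ^ 2 + 2 * r * Real.cos θ := by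
  nlinarith [Real.neg_one_le_cos θ, mul_nonneg hr0 (by linarith [Real.neg_one_le_cos θ] :
    0 ≤ Real.cos θ + 1), mul_pos (sub_pos.2 hr1) (sub_pos.2 hr1)]

lemma continuous_angleWeight {r : ℝ} (hr0 : 0 ≤ r) (hr1 : r < 1) (c₁ c₂ d : ℝ) :
    Continuous (angleWeight c₁ c₂ d r) := by
  unfold angleWeight
  have : Continuous fun θ => (1 - r ^ 2) / (1 + r ^ 2 + 2 * r * Real.cos θ) :=
    continuous_const.div (by fun_prop) fun θ => (poisson_denom_pos hr0 hr1 θ).ne'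
  fun_prop

/-- The value on `|z| ≥ 1` of the logarithmic potential of the circle measure with density
`angleWeight`. -/
noncomputable def circlePotential (c₁ c₂ d r : ℝ) (z : ℂ) : ℝ :=
  Real.log ‖z‖ - c₁ / 2 * (z⁻¹).re - c₂ / 4 * ((z ^ 2)⁻¹).re + d * Real.log ‖1 + r / z‖

lemma intervalIntegrable_log_norm (z : ℂ) :
    IntervalIntegrable (fun θ => Real.log ‖circleMap 0 1 θ - z‖) volume 0 (2 * Real.pi) :=
  circleIntegrable_log_norm_sub_const (c := 0) (a := z) 1

lemma intervalIntegrable_angleWeight_mul_log {r : ℝ} (hr0 : 0 ≤ r) (hr1 : r < 1) (c₁ c₂ d : ℝ)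
    (z : ℂ) : IntervalIntegrable
      (fun θ => angleWeight c₁ c₂ d r θ * Real.log ‖circleMap 0 1 θ - z‖) volume 0
      (2 * Real.pi) :=
  (intervalIntegrable_log_norm z).continuousOn_mul
    (continuous_angleWeight hr0 hr1 c₁ c₂ d).continuousOn

lemma integral_angleWeight_of_one_lt {r : ℝ} (hr0 : 0 ≤ r) (hr1 : r < 1) (c₁ c₂ d : ℝ) {z : ℂ}
    (hz : 1 < ‖z‖) :
    ∫ θ in 0..2 * Real.pi, angleWeight c₁ c₂ d r θ * Real.log ‖circleMap 0 1 θ - z‖ =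
      2 * Real.pi * circlePotential c₁ c₂ d r z := by
  have hl := intervalIntegrable_log_norm z
  have i1 : IntervalIntegrable (fun θ => Real.cos θ * Real.log ‖circleMap 0 1 θ - z‖) volume 0
      (2 * Real.pi) := hl.continuousOn_mul (by fun_prop)
  have i2 : IntervalIntegrable (fun θ => Real.cos (2 * θ) * Real.log ‖circleMap 0 1 θ - z‖)
      volume 0 (2 * Real.pi) := hl.continuousOn_mul (by fun_prop)
  have i3 : IntervalIntegrable (fun θ => (1 - r ^ 2) / (1 + r ^ 2 + 2 * r * Real.cos θ) *
      Real.log ‖circleMap 0 1 θ - z‖) volume 0 (2 * Real.pi) :=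
    hl.continuousOn_mul (continuous_const.div (by fun_prop)
      fun θ => (poisson_denom_pos hr0 hr1 θ).ne').continuousOn
  have h0 : ∫ θ in 0..2 * Real.pi, Real.log ‖circleMap 0 1 θ - z‖ =
      2 * Real.pi * Real.log ‖z‖ := by
    have := circleAverage_log_norm_sub_const₂ hz
    rwa [Real.circleAverage_def, smul_eq_mul, inv_mul_eq_iff_eq_mul₀ (by positivity)] at this
  have hrw : ∀ θ : ℝ, angleWeight c₁ c₂ d r θ * Real.log ‖circleMap 0 1 θ - z‖ =
      (((1 - d) * Real.log ‖circleMap 0 1 θ - z‖ +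
      c₁ * (Real.cos θ * Real.log ‖circleMap 0 1 θ - z‖)) +
      c₂ * (Real.cos (2 * θ) * Real.log ‖circleMap 0 1 θ - z‖)) +
      d * ((1 - r ^ 2) / (1 + r ^ 2 + 2 * r * Real.cos θ) *
        Real.log ‖circleMap 0 1 θ - z‖) := fun θ => by
    rw [angleWeight]; ring
  simp_rw [hrw]
  rw [intervalIntegral.integral_add (((hl.const_mul _).add (i1.const_mul _)).add
      (i2.const_mul _)) (i3.const_mul _),
    intervalIntegral.integral_add ((hl.const_mul _).add (i1.const_mul _)) (i2.const_mul _),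
    intervalIntegral.integral_add (hl.const_mul _) (i1.const_mul _)]
  simp only [intervalIntegral.integral_const_mul]
  rw [h0, integral_cos_one hz, integral_cos_two hz, integral_poisson hz hr0 hr1, circlePotential]
  ring

lemma one_add_div_ne_zero {r : ℝ} (hr0 : 0 ≤ r) (hr1 : r < 1) {z : ℂ} (hz : 1 ≤ ‖z‖) :
    1 + r / z ≠ 0 := by
  intro h
  have hz0 : z ≠ 0 := norm_pos_iff.1 (by linarith)
  have h1 : z = -r := by field_simp at h; linear_combination h
  rw [h1] at hz; simp [abs_of_nonneg hr0] at hz; linarith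

/-- The case `‖z‖ = 1`, which corresponds to points of the support, follows from the exterior
formula at `R z` by dominated convergence as `R` decreases to `1`. -/
lemma integral_angleWeight {r : ℝ} (hr0 : 0 ≤ r) (hr1 : r < 1) (c₁ c₂ d : ℝ) {z : ℂ}
    (hz : 1 ≤ ‖z‖) :
    ∫ θ in 0..2 * Real.pi, angleWeight c₁ c₂ d r θ * Real.log ‖circleMap 0 1 θ - z‖ =
      2 * Real.pi * circlePotential c₁ c₂ d r z := by
  rcases hz.lt_or_eq with hz | hz
  · exact integral_angleWeight_of_one_lt hr0 hr1 c₁ c₂ d hz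
  have hz0 : z ≠ 0 := norm_pos_iff.1 (by linarith)
  have hnorm : ∀ R : ℝ, 1 < R → ‖(R : ℂ) * z‖ = R := fun R hR => by
    rw [norm_mul, ← hz, mul_one, norm_real, Real.norm_eq_abs, abs_of_pos (by linarith)]
  have hmul : Tendsto (fun R : ℝ => (R : ℂ) * z) (𝓝[>] 1) (𝓝 z) := by
    have : Continuous fun R : ℝ => (R : ℂ) * z := by fun_prop
    have := this.tendsto 1
    simp only [ofReal_one, one_mul] at this
    exact this.mono_left nhdsWithin_le_nhds
  have hR : Tendsto (fun R : ℝ => 2 * Real.pi * circlePotential c₁ c₂ d r (R * z)) (𝓝[>] 1)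
      (𝓝 (2 * Real.pi * circlePotential c₁ c₂ d r z)) := by
    refine Tendsto.const_mul _ ?_
    have hc : ContinuousAt (circlePotential c₁ c₂ d r) z := by
      unfold circlePotential
      have h1 := one_add_div_ne_zero hr0 hr1 hz.le
      have h2 : ContinuousAt (fun z : ℂ => 1 + r / z) z :=
        continuousAt_const.add (continuousAt_const.div continuousAt_id hz0)
      have h3 : ContinuousAt (fun z : ℂ => (z⁻¹).re) z :=
        continuous_re.continuousAt.comp (continuousAt_inv₀ hz0)
      have h4 : ContinuousAt (fun z : ℂ => ((z ^ 2)⁻¹).re) z :=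
        continuous_re.continuousAt.comp ((continuousAt_id.pow 2).inv₀ (pow_ne_zero 2 hz0))
      have h5 : ContinuousAt (fun z : ℂ => Real.log ‖z‖) z :=
        continuousAt_id.norm.log (norm_ne_zero_iff.2 hz0)
      have h6 : ContinuousAt (fun z : ℂ => Real.log ‖1 + r / z‖) z :=
        h2.norm.log (norm_ne_zero_iff.2 h1)
      exact ((h5.sub (continuousAt_const.mul h3)).sub (continuousAt_const.mul h4)).add
        (continuousAt_const.mul h6)
    exact hc.tendsto.comp hmul
  have hne : ∀ᵐ θ : ℝ, circleMap 0 1 θ ≠ z := by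
    have : (circleMap 0 1 ⁻¹' {z}).Countable :=
      (countable_singleton z).preimage_circleMap 0 one_ne_zero
    filter_upwards [this.ae_notMem volume] with θ hθ h using hθ h
  refine tendsto_nhds_unique (f := fun R : ℝ => ∫ θ in 0..2 * Real.pi,
    angleWeight c₁ c₂ d r θ * Real.log ‖circleMap 0 1 θ - R * z‖) (l := 𝓝[>] 1) ?_
    (hR.congr' ?_)
  · refine intervalIntegral.tendsto_integral_filter_of_dominated_convergence
      (fun θ => |angleWeight c₁ c₂ d r θ| * (|Real.log ‖circleMap 0 1 θ - z‖| + 2)) ?_ ?_ ?_ ?_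
    · refine Eventually.of_forall fun R => Measurable.aestronglyMeasurable ?_
      exact (continuous_angleWeight hr0 hr1 c₁ c₂ d).measurable.mul
        (Real.measurable_log.comp (by fun_prop : Continuous _).measurable)
    · have hlt : ∀ᶠ R : ℝ in 𝓝[>] 1, R < 2 :=
        nhdsWithin_le_nhds (eventually_lt_nhds (by norm_num))
      filter_upwards [self_mem_nhdsWithin, hlt] with R (hR1 : 1 < R) hR2
      filter_upwards [hne] with θ hθ _
      rw [norm_mul, Real.norm_eq_abs, Real.norm_eq_abs]
      refine mul_le_mul_of_nonneg_left ?_ (abs_nonneg _)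
      have hp : 0 < ‖circleMap 0 1 θ - z‖ := norm_pos_iff.2 (sub_ne_zero.2 hθ)
      have hdist : ‖(R : ℂ) * z - z‖ = R - 1 := by
        rw [show (R : ℂ) * z - z = ((R - 1 : ℝ) : ℂ) * z by push_cast; ring, norm_mul, ← hz,
          mul_one, norm_real, Real.norm_eq_abs, abs_of_pos (by linarith)]
      have hc1 : ‖circleMap 0 1 θ‖ = 1 := by simp
      -- The distance from `R z` to the circle is `R - 1`, also its distance to `z`; the triangle
      -- inequality then loses only a factor `2`, which makes the bound uniform in `R`.
      have hlow : ‖circleMap 0 1 θ - z‖ / 2 ≤ ‖circleMap 0 1 θ - R * z‖ := by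
        have h1 := norm_sub_norm_le ((R : ℂ) * z) (circleMap 0 1 θ)
        rw [hnorm R hR1, hc1, norm_sub_rev] at h1
        have h2 := norm_sub_le_norm_sub_add_norm_sub (circleMap 0 1 θ) ((R : ℂ) * z) z
        rw [hdist] at h2
        linarith
      have hup : ‖circleMap 0 1 θ - R * z‖ ≤ 3 := by
        have := norm_sub_le (circleMap 0 1 θ) (R * z)
        rw [hnorm R hR1, hc1] at this; linarith
      have hl2 : Real.log 2 ≤ 2 := (Real.log_le_self (by norm_num))
      have hl3 : Real.log 3 ≤ 2 := (Real.log_le_sub_one_of_pos (by norm_num)).trans (by norm_num)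
      have e1 := Real.log_le_log (by positivity) hlow
      have e2 := Real.log_le_log (by linarith : 0 < ‖circleMap 0 1 θ - R * z‖) hup
      rw [Real.log_div hp.ne' two_ne_zero] at e1
      have e3 := neg_abs_le (Real.log ‖circleMap 0 1 θ - z‖)
      have e4 := abs_nonneg (Real.log ‖circleMap 0 1 θ - z‖)
      rw [abs_le]; constructor <;> linarith
    · exact ((intervalIntegrable_log_norm z).abs.add intervalIntegrable_const).continuousOn_mul
        (continuous_angleWeight hr0 hr1 c₁ c₂ d).abs.continuousOn
    · filter_upwards [hne] with θ hθ _
      refine Tendsto.const_mul _ (Tendsto.log ?_ (norm_ne_zero_iff.2 (sub_ne_zero.2 hθ)))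
      exact (tendsto_const_nhds.sub hmul).norm
  · filter_upwards [self_mem_nhdsWithin] with R (hR1 : 1 < R)
    exact (integral_angleWeight_of_one_lt hr0 hr1 c₁ c₂ d (by rw [hnorm R hR1]; exact hR1)).symm

end LogEquilibrium

/-! ### From the circle to an interval through the Joukowski map. -/

namespace LogEquilibrium

open MeasureTheory Set Filter Topology Complex Metric
open Real (circleAverage)

/-- The image under `θ ↦ m + h cos θ` of the measure with density `w / π` on `(0, π)`. -/
noncomputable def arcMeasure (m h : ℝ) (w : ℝ → ℝ) : Measure ℝ :=
  ((volume.restrict (Ioo 0 Real.pi)).withDensity fun θ => ENNReal.ofReal (w θ / Real.pi)).map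
    fun θ => m + h * Real.cos θ

lemma measurable_add_mul_cos (m h : ℝ) : Measurable fun θ => m + h * Real.cos θ := by fun_prop

lemma image_add_mul_cos (m : ℝ) {h : ℝ} (hh : 0 < h) :
    (fun θ => m + h * Real.cos θ) '' Ioo 0 Real.pi = Ioo (m - h) (m + h) := by
  ext x
  constructor
  · rintro ⟨θ, hθ, rfl⟩
    have h1 : Real.cos θ < 1 := by
      rw [← Real.cos_zero]
      exact Real.strictAntiOn_cos ⟨le_rfl, Real.pi_pos.le⟩ (Ioo_subset_Icc_self hθ) hθ.1
    have h2 : -1 < Real.cos θ := by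
      rw [← Real.cos_pi]
      exact Real.strictAntiOn_cos (Ioo_subset_Icc_self hθ) ⟨Real.pi_pos.le, le_rfl⟩ hθ.2
    constructor <;> nlinarith
  · intro hx
    have h1 : -1 < (x - m) / h := by rw [lt_div_iff₀ hh]; linarith [hx.1]
    have h2 : (x - m) / h < 1 := by rw [div_lt_iff₀ hh]; linarith [hx.2]
    refine ⟨Real.arccos ((x - m) / h), ⟨Real.arccos_pos.2 h2, ?_⟩, ?_⟩
    · refine lt_of_le_of_ne (Real.arccos_le_pi _) fun h3 => ?_
      rw [Real.arccos_eq_pi] at h3; linarith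
    · simp only
      rw [Real.cos_arccos h1.le h2.le]; field_simp; ring

lemma injOn_add_mul_cos (m : ℝ) {h : ℝ} (hh : 0 < h) :
    InjOn (fun θ => m + h * Real.cos θ) (Ioo 0 Real.pi) := fun _ hx _ hy hxy =>
  Real.injOn_cos (Ioo_subset_Icc_self hx) (Ioo_subset_Icc_self hy)
    (mul_left_cancel₀ hh.ne' (add_left_cancel hxy))

/-- The change of variables `x = (a + b) / 2 + (b - a) / 2 * cos θ`; the end points are null, so `T`
may contain them or not. -/
lemma densityMeasure_eq_arcMeasure {a b : ℝ} (hab : a < b) {T : Set ℝ} (hT1 : Ioo a b ⊆ T)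
    (hT2 : T ⊆ Icc a b) {f w : ℝ → ℝ}
    (hf : ∀ θ ∈ Ioo 0 Real.pi, (b - a) / 2 * Real.sin θ * f ((a + b) / 2 + (b - a) / 2 * Real.cos θ)
      = w θ / Real.pi) :
    densityMeasure T f = arcMeasure ((a + b) / 2) ((b - a) / 2) w := by
  have hh : 0 < (b - a) / 2 := by linarith
  have hTae : T =ᵐ[volume] Ioo a b := by
    refine ae_eq_set.2 ⟨?_, by rw [sdiff_eq_empty.2 hT1, measure_empty]⟩
    refine measure_mono_null (sdiff_subset_sdiff_left hT2) ?_
    exact (ae_eq_set.1 (Ioo_ae_eq_Icc (μ := volume) (a := a) (b := b))).2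
  rw [densityMeasure, Measure.restrict_congr_set hTae]
  have him := image_add_mul_cos ((a + b) / 2) hh
  rw [show (a + b) / 2 - (b - a) / 2 = a by ring, show (a + b) / 2 + (b - a) / 2 = b by ring]
    at him
  ext s hs
  have hm := measurable_add_mul_cos ((a + b) / 2) ((b - a) / 2)
  rw [arcMeasure, Measure.map_apply hm hs, withDensity_apply _ hs, withDensity_apply _ (hm hs),
    ← lintegral_indicator hs, ← lintegral_indicator (hm hs), ← him,
    lintegral_image_eq_lintegral_abs_deriv_mul measurableSet_Ioo
      (f' := fun θ => (b - a) / 2 * -Real.sin θ) (fun θ _ =>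
        (((Real.hasDerivAt_cos θ).const_mul _).const_add _).hasDerivWithinAt)
      (injOn_add_mul_cos _ hh)]
  refine setLIntegral_congr_fun measurableSet_Ioo fun θ hθ => ?_
  have hsin : 0 < Real.sin θ := Real.sin_pos_of_mem_Ioo hθ
  have habs : |(b - a) / 2 * -Real.sin θ| = (b - a) / 2 * Real.sin θ := by
    rw [mul_neg, abs_neg, abs_of_pos (mul_pos hh hsin)]
  rw [habs]
  by_cases hmem : (a + b) / 2 + (b - a) / 2 * Real.cos θ ∈ s
  · rw [indicator_of_mem hmem, indicator_of_mem (by exact hmem),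
      ← ENNReal.ofReal_mul (mul_pos hh hsin).le, hf θ hθ]
  · rw [indicator_of_notMem hmem, indicator_of_notMem (by exact hmem), mul_zero]

variable {m h : ℝ} {w : ℝ → ℝ}

lemma ae_arcMeasure_mem (hh : 0 < h) : ∀ᵐ x ∂arcMeasure m h w, x ∈ Ioo (m - h) (m + h) := by
  rw [arcMeasure, ae_map_iff (p := fun x => x ∈ Ioo (m - h) (m + h))
    (measurable_add_mul_cos m h).aemeasurable measurableSet_Ioo]
  refine (withDensity_absolutelyContinuous _ _).ae_le ?_
  filter_upwards [ae_restrict_mem measurableSet_Ioo] with θ hθ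
  rw [← image_add_mul_cos m hh]
  exact mem_image_of_mem _ hθ

lemma integral_arcMeasure (hw : Continuous w) (hw0 : ∀ θ, 0 ≤ w θ) {g : ℝ → ℝ}
    (hg : Measurable g) :
    ∫ x, g x ∂arcMeasure m h w =
      Real.pi⁻¹ * ∫ θ in 0..Real.pi, w θ * g (m + h * Real.cos θ) := by
  have hd : Measurable fun θ => Real.toNNReal (w θ / Real.pi) :=
    (hw.measurable.div_const _).real_toNNReal
  rw [arcMeasure, integral_map (measurable_add_mul_cos m h).aemeasurable
    hg.aestronglyMeasurable]
  have := integral_withDensity_eq_integral_smul (μ := volume.restrict (Ioo 0 Real.pi)) hd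
    (fun θ => g (m + h * Real.cos θ))
  simp only [ENNReal.ofReal]
  rw [this, intervalIntegral.integral_of_le Real.pi_pos.le, integral_Ioc_eq_integral_Ioo,
    ← integral_const_mul]
  congr 1; ext θ
  rw [NNReal.smul_def, Real.coe_toNNReal _ (div_nonneg (hw0 θ) Real.pi_pos.le), smul_eq_mul]
  ring

lemma integrable_arcMeasure (hw : Continuous w) (hw0 : ∀ θ, 0 ≤ w θ) {g : ℝ → ℝ}
    (hg : Measurable g)
    (hi : IntervalIntegrable (fun θ => w θ * g (m + h * Real.cos θ)) volume 0 Real.pi) :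
    Integrable g (arcMeasure m h w) := by
  have hd : Measurable fun θ => Real.toNNReal (w θ / Real.pi) :=
    (hw.measurable.div_const _).real_toNNReal
  rw [arcMeasure, integrable_map_measure hg.aestronglyMeasurable
    (measurable_add_mul_cos m h).aemeasurable]
  have := integrable_withDensity_iff_integrable_smul (μ := volume.restrict (Ioo 0 Real.pi)) hd
    (g := fun θ => g (m + h * Real.cos θ))
  simp only [ENNReal.ofReal]
  refine this.2 ?_
  rw [intervalIntegrable_iff_integrableOn_Ioo_of_le Real.pi_pos.le] at hi
  refine (hi.const_mul Real.pi⁻¹).congr (ae_of_all _ fun θ => ?_)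
  simp only
  rw [NNReal.smul_def, Real.coe_toNNReal _ (div_nonneg (hw0 θ) Real.pi_pos.le), smul_eq_mul]
  ring

lemma angleWeight_two_pi_sub (c₁ c₂ d r θ : ℝ) :
    angleWeight c₁ c₂ d r (2 * Real.pi - θ) = angleWeight c₁ c₂ d r θ := by
  have h2 : Real.cos (2 * (2 * Real.pi - θ)) = Real.cos (2 * θ) := by
    rw [Real.cos_two_mul, Real.cos_two_mul, Real.cos_two_pi_sub]
  simp only [angleWeight, Real.cos_two_pi_sub, h2]

lemma integral_reflect {g : ℝ → ℝ} (hg : IntervalIntegrable g volume 0 (2 * Real.pi)) :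
    IntervalIntegrable (fun θ => g θ + g (2 * Real.pi - θ)) volume 0 Real.pi ∧
    ∫ θ in 0..Real.pi, (g θ + g (2 * Real.pi - θ)) = ∫ θ in 0..2 * Real.pi, g θ := by
  have hpi := Real.pi_pos
  have g1 : IntervalIntegrable g volume 0 Real.pi := hg.mono_set (by
    rw [uIcc_of_le hpi.le, uIcc_of_le (by linarith)]; exact Icc_subset_Icc le_rfl (by linarith))
  have g2 : IntervalIntegrable g volume Real.pi (2 * Real.pi) := hg.mono_set (by
    rw [uIcc_of_le (by linarith), uIcc_of_le (by linarith)]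
    exact Icc_subset_Icc hpi.le le_rfl)
  have g3 : IntervalIntegrable (fun θ => g (2 * Real.pi - θ)) volume 0 Real.pi := by
    have := (g2.comp_sub_left (2 * Real.pi)).symm
    simpa [two_mul] using this
  refine ⟨g1.add g3, ?_⟩
  rw [intervalIntegral.integral_add g1 g3, intervalIntegral.integral_comp_sub_left,
    show 2 * Real.pi - Real.pi = Real.pi by ring, sub_zero,
    intervalIntegral.integral_add_adjacent_intervals g1 g2]

/-- The cosines have mean zero and the Poisson kernel has mean one, so no coefficient affects the
mass; symmetry gives half of the full circle. -/
lemma integral_angleWeight_eq_pi {r : ℝ} (hr0 : 0 ≤ r) (hr1 : r < 1) (c₁ c₂ d : ℝ) :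
    ∫ θ in 0..Real.pi, angleWeight c₁ c₂ d r θ = Real.pi := by
  have hw := continuous_angleWeight hr0 hr1 c₁ c₂ d
  have hP : Continuous fun θ => (1 - r ^ 2) / (1 + r ^ 2 + 2 * r * Real.cos θ) :=
    continuous_const.div (by fun_prop) fun θ => (poisson_denom_pos hr0 hr1 θ).ne'
  have hpois : ∫ θ in 0..2 * Real.pi, (1 - r ^ 2) / (1 + r ^ 2 + 2 * r * Real.cos θ) =
      2 * Real.pi := by
    have hw : (-r : ℂ) ∈ ball (0 : ℂ) 1 := by simp [abs_of_nonneg hr0, hr1]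
    have h := (diffContOnCl_const (c := (1 : ℂ)) (𝕜 := ℂ)
      (s := ball (0 : ℂ) 1)).circleAverage_poissonKernel_smul hw
    have h' := congrArg (fun z : ℂ => z.re) h
    rw [Real.circleAverage_def] at h'
    have hcg : ∀ θ : ℝ, (poissonKernel 0 (-r : ℂ) • fun ζ : ℂ => (1 : ℂ)) (circleMap 0 1 θ) =
        (((1 - r ^ 2) / (1 + r ^ 2 + 2 * r * Real.cos θ) : ℝ) : ℂ) := by
      intro θ
      rw [Pi.smul_apply', real_smul, mul_one, poissonKernel_def]
      congr 2
      · simp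
      · rw [← normSq_eq_norm_sq, normSq_apply]
        simp [circleMap]
        nlinarith [Real.sin_sq_add_cos_sq θ]
    simp_rw [hcg] at h'
    rw [intervalIntegral.integral_ofReal, real_smul, ← ofReal_mul, ofReal_re, one_re,
      inv_mul_eq_iff_eq_mul₀ (by positivity), mul_one] at h'
    exact h'
  have key := (integral_reflect (g := angleWeight c₁ c₂ d r)
    (hw.intervalIntegrable 0 (2 * Real.pi))).2
  simp only [angleWeight_two_pi_sub, ← two_mul] at key
  rw [intervalIntegral.integral_const_mul] at key
  have hfull : ∫ θ in 0..2 * Real.pi, angleWeight c₁ c₂ d r θ = 2 * Real.pi := by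
    unfold angleWeight
    have c1 : ∫ θ in 0..2 * Real.pi, Real.cos θ = 0 := by simp
    have c2 : ∫ θ in 0..2 * Real.pi, Real.cos (2 * θ) = 0 := by
      rw [intervalIntegral.integral_comp_mul_left (fun x => Real.cos x) two_ne_zero]
      have : Real.sin (2 * (2 * Real.pi)) = 0 := by
        have := Real.sin_nat_mul_two_pi_sub 0 2
        rw [sub_zero, Real.sin_zero, neg_zero] at this
        exact_mod_cast this
      simp [this]
    rw [intervalIntegral.integral_add ((by fun_prop : Continuous _).intervalIntegrable _ _)
        ((by fun_prop : Continuous _).intervalIntegrable _ _),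
      intervalIntegral.integral_add ((by fun_prop : Continuous _).intervalIntegrable _ _)
        ((by fun_prop : Continuous _).intervalIntegrable _ _),
      intervalIntegral.integral_add ((by fun_prop : Continuous _).intervalIntegrable _ _)
        ((by fun_prop : Continuous _).intervalIntegrable _ _),
      intervalIntegral.integral_const_mul, intervalIntegral.integral_const_mul,
      intervalIntegral.integral_const_mul,
      intervalIntegral.integral_sub (hP.intervalIntegrable _ _)
        ((by fun_prop : Continuous _).intervalIntegrable _ _), c1, c2, hpois]
    simp
  linarith

lemma isProbabilityMeasure_arcMeasure {r : ℝ} (hr0 : 0 ≤ r) (hr1 : r < 1) {c₁ c₂ d : ℝ}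
    (hw0 : ∀ θ, 0 ≤ angleWeight c₁ c₂ d r θ) :
    IsProbabilityMeasure (arcMeasure m h (angleWeight c₁ c₂ d r)) := by
  have hw := continuous_angleWeight hr0 hr1 c₁ c₂ d
  constructor
  rw [arcMeasure, Measure.map_apply (measurable_add_mul_cos m h) MeasurableSet.univ,
    preimage_univ, withDensity_apply _ MeasurableSet.univ, Measure.restrict_univ,
    ← ofReal_integral_eq_lintegral_ofReal, integral_div, ← integral_Ioc_eq_integral_Ioo,
    ← intervalIntegral.integral_of_le Real.pi_pos.le, integral_angleWeight_eq_pi hr0 hr1,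
    div_self Real.pi_ne_zero, ENNReal.ofReal_one]
  · exact (((hw.div_const _).intervalIntegrable 0 Real.pi).1).mono_set Ioo_subset_Ioc_self
  · exact ae_of_all _ fun θ => div_nonneg (hw0 θ) Real.pi_pos.le

lemma circleMap_two_pi_sub_eq (θ : ℝ) : circleMap 0 1 (2 * Real.pi - θ) = (circleMap 0 1 θ)⁻¹ := by
  rw [circleMap_zero_inv, inv_one, show 2 * Real.pi - θ = -θ + 2 * Real.pi by ring,
    periodic_circleMap]

/-- The identity `(ζ - z)(ζ⁻¹ - z) / z = z + z⁻¹ - (ζ + ζ⁻¹)`. After taking logarithms, the two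
factors turn an integral over the half circle into one over the full circle. -/
lemma joukowski_sub {z : ℂ} (hz : z ≠ 0) {y : ℝ} (hy : (y : ℂ) = m + h / 2 * (z + z⁻¹))
    (hh : 0 < h) (θ : ℝ) :
    |y - (m + h * Real.cos θ)| = h / 2 * (‖circleMap 0 1 θ - z‖ *
      ‖circleMap 0 1 (2 * Real.pi - θ) - z‖) / ‖z‖ := by
  have he : circleMap 0 1 θ ≠ 0 := circleMap_ne_center one_ne_zero
  have hcos : ((Real.cos θ : ℝ) : ℂ) = (circleMap 0 1 θ + (circleMap 0 1 θ)⁻¹) / 2 := by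
    simpa using cos_nat_mul_eq 1 θ
  have hnorm : ‖(h / 2 : ℂ)‖ = h / 2 := by
    rw [show (h / 2 : ℂ) = ((h / 2 : ℝ) : ℂ) by push_cast; rfl, norm_real, Real.norm_eq_abs,
      abs_of_pos (by linarith)]
  rw [circleMap_two_pi_sub_eq, ← Real.norm_eq_abs, ← norm_real, ← norm_mul, ← hnorm, ← norm_mul,
    ← norm_div]
  congr 1
  push_cast [hy]
  rw [← ofReal_cos, hcos]
  field_simp
  ring

/-- The logarithmic potential of an arc measure, in the Joukowski coordinate. -/
lemma potential_arcMeasure {r : ℝ} (hr0 : 0 ≤ r) (hr1 : r < 1) {c₁ c₂ d : ℝ}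
    (hw0 : ∀ θ, 0 ≤ angleWeight c₁ c₂ d r θ) (hh : 0 < h) {z : ℂ} (hz : 1 ≤ ‖z‖) {y : ℝ}
    (hy : (y : ℂ) = m + h / 2 * (z + z⁻¹)) :
    Integrable (fun x => Real.log |y - x|) (arcMeasure m h (angleWeight c₁ c₂ d r)) ∧
    ∫ x, Real.log |y - x| ∂arcMeasure m h (angleWeight c₁ c₂ d r) =
      Real.log (h / 2) - Real.log ‖z‖ + 2 * circlePotential c₁ c₂ d r z := by
  have hw := continuous_angleWeight hr0 hr1 c₁ c₂ d
  have hz0 : z ≠ 0 := norm_pos_iff.1 (by linarith)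
  have hg : Measurable fun x => Real.log |y - x| := Real.measurable_log.comp (by fun_prop)
  have hne : ∀ᵐ θ : ℝ, circleMap 0 1 θ ≠ z ∧ circleMap 0 1 (2 * Real.pi - θ) ≠ z := by
    have h1 : (circleMap 0 1 ⁻¹' {z}).Countable :=
      (countable_singleton z).preimage_circleMap 0 one_ne_zero
    have h2 : (circleMap 0 1 ⁻¹' {z⁻¹}).Countable :=
      (countable_singleton z⁻¹).preimage_circleMap 0 one_ne_zero
    filter_upwards [h1.ae_notMem volume, h2.ae_notMem volume] with θ h1 h2
    refine ⟨fun h => h1 h, fun h => h2 ?_⟩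
    rw [circleMap_two_pi_sub_eq] at h
    rw [mem_preimage, mem_singleton_iff, ← h, inv_inv]
  obtain ⟨i1, e1⟩ := integral_reflect (intervalIntegrable_angleWeight_mul_log hr0 hr1 c₁ c₂ d z)
  have i2 : IntervalIntegrable (fun θ => angleWeight c₁ c₂ d r θ * (Real.log (h / 2) -
      Real.log ‖z‖)) volume 0 Real.pi := (hw.mul continuous_const).intervalIntegrable _ _
  have hcg : ∀ᵐ θ : ℝ, angleWeight c₁ c₂ d r θ * (Real.log (h / 2) - Real.log ‖z‖) +
      (angleWeight c₁ c₂ d r θ * Real.log ‖circleMap 0 1 θ - z‖ +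
        angleWeight c₁ c₂ d r (2 * Real.pi - θ) *
          Real.log ‖circleMap 0 1 (2 * Real.pi - θ) - z‖) =
      angleWeight c₁ c₂ d r θ * Real.log |y - (m + h * Real.cos θ)| := by
    filter_upwards [hne] with θ hθ
    have p1 : ‖circleMap 0 1 θ - z‖ ≠ 0 := norm_ne_zero_iff.2 (sub_ne_zero.2 hθ.1)
    have p2 : ‖circleMap 0 1 (2 * Real.pi - θ) - z‖ ≠ 0 :=
      norm_ne_zero_iff.2 (sub_ne_zero.2 hθ.2)
    rw [joukowski_sub hz0 hy hh, angleWeight_two_pi_sub, Real.log_div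
      (mul_ne_zero (by positivity) (mul_ne_zero p1 p2)) (norm_ne_zero_iff.2 hz0),
      Real.log_mul (by positivity) (mul_ne_zero p1 p2), Real.log_mul p1 p2]
    ring
  constructor
  · refine integrable_arcMeasure hw hw0 hg ((i2.add i1).congr_ae ?_)
    exact ae_restrict_of_ae hcg
  · rw [integral_arcMeasure hw hw0 hg, ← intervalIntegral.integral_congr_ae
      (hcg.mono fun θ hθ _ => hθ), intervalIntegral.integral_add i2 i1, e1,
      integral_angleWeight hr0 hr1 c₁ c₂ d hz, intervalIntegral.integral_mul_const,
      integral_angleWeight_eq_pi hr0 hr1]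
    have := Real.pi_ne_zero
    field_simp

end LogEquilibrium

/-! ### The edge relations, the sign of the density and the effective potential. -/

namespace LogEquilibrium

open MeasureTheory Set Filter Topology Complex Metric

/-- The algebraic relations between the midpoint `m` and the half-length `h` of the support
`[a, b]`, the Joukowski preimage `-r` of the origin, `p = √(a b)` and `q = √(a / b)`. -/
structure EdgeData (α m h r p q : ℝ) : Prop where
  alpha_nonneg : 0 ≤ α
  h_pos : 0 < h
  r_nonneg : 0 ≤ r
  r_lt_one : r < 1
  q_nonneg : 0 ≤ q
  origin : α = 0 ∨ (0 < r ∧ 2 * r * m = h * (1 + r ^ 2) ∧ 2 * r * p = h * (1 - r ^ 2) ∧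
    p = q * (m + h))
  psi_eq : 3 * h ^ 2 + 2 * (m - h) * h + 2 * α * q - 2 * α - 2 = 0
  phi_nonneg : 0 ≤ m - α * q / (m - h)

/-- The factor that the density has besides its zero at the right end point. -/
noncomputable def edgeFactor (α h q x : ℝ) : ℝ := x + h - α * q / x

/-- The difference between half the external field and the potential, in the Joukowski
coordinate. -/
noncomputable def effectivePotential (α m h r z : ℝ) : ℝ :=
  m * h / 2 * (z - z⁻¹) + h ^ 2 / 8 * (z ^ 2 - z⁻¹ ^ 2) - Real.log z -
    α * (Real.log (1 + r * z) - Real.log (1 + r * z⁻¹))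

namespace EdgeData

variable {α m h r p q : ℝ} (E : EdgeData α m h r p q)
include E

lemma left_pos (hα : 0 < α) : 0 < m - h := by
  rcases E.origin with h0 | ⟨hr, h1, -, -⟩
  · exact absurd h0 hα.ne'
  · have h2 : 2 * r * (m - h) = h * (1 - r) ^ 2 := by linear_combination h1
    have h3 : 0 < h * (1 - r) ^ 2 := mul_pos E.h_pos (pow_pos (sub_pos.2 E.r_lt_one) 2)
    rw [← h2] at h3
    exact pos_of_mul_pos_right h3 (by linarith)

lemma field_pos (hα : 0 < α) {x : ℝ} (hx : m - h ≤ x) : 0 < x :=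
  (E.left_pos hα).trans_le hx

/-- The left side is the angular weight in the variable `x`; `psi_eq` says exactly that it vanishes
at the right end point `m + h`, which splits off the linear factor. -/
lemma weight_eq {x : ℝ} (hx : 0 < α → x ≠ 0) :
    1 + α + h ^ 2 / 2 + m * x - x ^ 2 - α * (p / x) = (m + h - x) * edgeFactor α h q x := by
  have hψ := E.psi_eq
  rcases E.origin with rfl | ⟨hr, h1, h2, h3⟩
  · simp only [edgeFactor, zero_mul, zero_div]
    linear_combination (-1 / 2) * hψ
  · rcases E.alpha_nonneg.eq_or_lt with rfl | hα
    · simp only [edgeFactor, zero_mul, zero_div]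
      linear_combination (-1 / 2) * hψ
    · have := hx hα
      rw [edgeFactor, h3]
      field_simp
      linear_combination (-x) * hψ

/-- For `α > 0` the Poisson kernel at `-r` equals `p / x`, because `-r` is the Joukowski preimage of
the origin. -/
lemma angleWeight_eq (θ : ℝ) :
    angleWeight (-(m * h)) (-(h ^ 2 / 2)) (-α) r θ =
      (m + h - (m + h * Real.cos θ)) * edgeFactor α h q (m + h * Real.cos θ) := by
  have hx : m - h ≤ m + h * Real.cos θ := by nlinarith [Real.neg_one_le_cos θ, E.h_pos]
  rw [← E.weight_eq fun hα => (E.field_pos hα hx).ne', angleWeight, Real.cos_two_mul]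
  rcases E.alpha_nonneg.eq_or_lt with rfl | hα
  · ring
  · have hx0 := E.field_pos hα hx
    rcases E.origin with h0 | ⟨hr, h1, h2, h3⟩
    · exact absurd h0 hα.ne'
    · have hP : (1 - r ^ 2) / (1 + r ^ 2 + 2 * r * Real.cos θ) = p / (m + h * Real.cos θ) := by
        rw [div_eq_div_iff (poisson_denom_pos E.r_nonneg E.r_lt_one θ).ne' hx0.ne']
        have hh := E.h_pos.ne'
        have : h * ((1 - r ^ 2) * (m + h * Real.cos θ) -
            p * (1 + r ^ 2 + 2 * r * Real.cos θ)) = 0 := by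
          linear_combination (-(m + h * Real.cos θ)) * h2 + p * h1
        rcases mul_eq_zero.1 this with h | h
        · exact absurd h hh
        · linarith
      rw [hP]; ring

/-- The term `-α q / x` is nondecreasing for positive `x`. With `phi_nonneg` at the left end point
this makes the factor nonnegative on the support and beyond. -/
lemma edgeFactor_mono {x y : ℝ} (hx : 0 < α → 0 < x) (hxy : x ≤ y) :
    edgeFactor α h q x + (y - x) ≤ edgeFactor α h q y := by
  rcases E.alpha_nonneg.eq_or_lt with rfl | hα
  · simp [edgeFactor]; linarith
  · have hx := hx hα
    have : α * q / y ≤ α * q / x :=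
      div_le_div_of_nonneg_left (mul_nonneg hα.le E.q_nonneg) hx hxy
    simp only [edgeFactor]; linarith

omit E in
lemma edgeFactor_left : edgeFactor α h q (m - h) = m - α * q / (m - h) := by
  simp [edgeFactor]

lemma edgeFactor_ge {x : ℝ} (hx : m - h ≤ x) : x - (m - h) ≤ edgeFactor α h q x := by
  have h1 := E.edgeFactor_mono E.left_pos hx
  have h2 := E.phi_nonneg
  rw [edgeFactor_left] at h1
  linarith

lemma angleWeight_nonneg (θ : ℝ) : 0 ≤ angleWeight (-(m * h)) (-(h ^ 2 / 2)) (-α) r θ := by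
  have hh := E.h_pos
  have hx : m - h ≤ m + h * Real.cos θ := by nlinarith [Real.neg_one_le_cos θ]
  rw [E.angleWeight_eq]
  refine mul_nonneg (by nlinarith [Real.cos_le_one θ]) ?_
  exact (sub_nonneg.2 hx).trans (E.edgeFactor_ge hx)

/-- The zeros in `z` are the two preimages `-r` and `-1 / r` of the origin. -/
lemma joukowski_factor (hα : 0 < α) {z : ℝ} (hz : z ≠ 0) :
    2 * r * (m + h / 2 * (z + z⁻¹)) = h * ((1 + r * z) * (1 + r * z⁻¹)) := by
  rcases E.origin with h0 | ⟨hr, h1, h2, h3⟩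
  · exact absurd h0 hα.ne'
  · field_simp
    linear_combination z * h1

/-- The derivative is the weight, continued to real points off the support, times `-1 / z`; the sign
of the effective potential is thus read off from the two factors of the weight. Negative `z` is
allowed because `Real.log` depends only on the absolute value. -/
lemma hasDerivAt_effectivePotential {z : ℝ} (hz : z ≠ 0)
    (hy : 0 < α → m + h / 2 * (z + z⁻¹) ≠ 0) :
    HasDerivAt (effectivePotential α m h r)
      (-((m + h - (m + h / 2 * (z + z⁻¹))) * edgeFactor α h q (m + h / 2 * (z + z⁻¹))) / z) z := by
  have hinv := hasDerivAt_inv hz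
  have hid := hasDerivAt_id z
  have d1 := (hid.sub hinv).const_mul (m * h / 2)
  have d2 := ((hid.pow 2).sub (hinv.pow 2)).const_mul (h ^ 2 / 8)
  have d3 := Real.hasDerivAt_log hz
  rw [← E.weight_eq hy]
  rcases E.alpha_nonneg.eq_or_lt with rfl | hα
  · have := ((d1.add d2).sub d3)
    refine (this.congr_deriv ?_).congr_of_eventuallyEq (Eventually.of_forall fun t => ?_)
    · simp only [id, Nat.add_one_sub_one, pow_one, Nat.cast_ofNat]
      field_simp
      ring
    · simp [effectivePotential]
  · have hfac := E.joukowski_factor hα hz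
    rcases E.origin with h0 | ⟨hr, h1, h2, h3⟩
    · exact absurd h0 hα.ne'
    have hne : h * ((1 + r * z) * (1 + r * z⁻¹)) ≠ 0 := by
      rw [← hfac]; exact mul_ne_zero (by positivity) (hy hα)
    have n1 : 1 + r * z ≠ 0 := fun h' => hne (by rw [h']; ring)
    have n2 : 1 + r * z⁻¹ ≠ 0 := fun h' => hne (by rw [h']; ring)
    have d4 := ((hid.const_mul r).const_add 1).log n1
    have d5 := ((hinv.const_mul r).const_add 1).log n2
    have := ((d1.add d2).sub d3).sub ((d4.sub d5).const_mul α)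
    refine (this.congr_deriv ?_).congr_of_eventuallyEq (Eventually.of_forall fun t => rfl)
    have hquot : p / (m + h / 2 * (z + z⁻¹)) = (1 - r ^ 2) / ((1 + r * z) * (1 + r * z⁻¹)) := by
      rw [div_eq_div_iff (hy hα) (mul_ne_zero n1 n2)]
      have hh := E.h_pos.ne'
      have : h * (p * ((1 + r * z) * (1 + r * z⁻¹)) -
          (1 - r ^ 2) * (m + h / 2 * (z + z⁻¹))) = 0 := by
        linear_combination (-p) * hfac + (m + h / 2 * (z + z⁻¹)) * h2
      rcases mul_eq_zero.1 this with h | h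
      · exact absurd h hh
      · linarith
    rw [hquot]
    have n3 : z + r ≠ 0 := by
      intro h'; apply n2; field_simp; rw [h', mul_zero]
    have e2 : 1 + r * z⁻¹ = (z + r) / z := by field_simp
    simp only [id, Nat.add_one_sub_one, pow_one, Nat.cast_ofNat]
    rw [e2]
    have n4 : 1 + z * r ≠ 0 := by rwa [mul_comm]
    field_simp
    ring

/-- It vanishes at `z = 1`. Beyond, the point lies to the right of `m + h`, where the linear factor
is nonpositive and `edgeFactor` nonnegative, so the derivative is nonnegative. -/
lemma effectivePotential_nonneg_right {z : ℝ} (hz : 1 ≤ z) :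
    0 ≤ effectivePotential α m h r z := by
  have hh := E.h_pos
  have hge : ∀ t : ℝ, 1 ≤ t → m + h ≤ m + h / 2 * (t + t⁻¹) := fun t ht => by
    have : 2 ≤ t + t⁻¹ := by
      have h0 : 0 < t := by linarith
      have : t + t⁻¹ - 2 = (t - 1) ^ 2 / t := by field_simp; ring
      have : 0 ≤ (t - 1) ^ 2 / t := by positivity
      linarith
    nlinarith
  have hd : ∀ t : ℝ, 1 ≤ t → HasDerivAt (effectivePotential α m h r) _ t := fun t ht =>
    E.hasDerivAt_effectivePotential (by linarith) fun hα =>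
      (E.field_pos hα (by linarith [hge t ht])).ne'
  have hmono : MonotoneOn (effectivePotential α m h r) (Ici 1) := by
    refine monotoneOn_of_deriv_nonneg (convex_Ici 1)
      (fun t ht => (hd t ht).continuousAt.continuousWithinAt)
      (fun t ht => (hd t (interior_subset ht)).differentiableAt.differentiableWithinAt)
      fun t ht => ?_
    have ht : 1 ≤ t := interior_subset ht
    rw [(hd t ht).deriv]
    have h1 := hge t ht
    have h2 := E.edgeFactor_ge (x := m + h / 2 * (t + t⁻¹)) (by linarith)
    refine div_nonneg ?_ (by linarith)
    nlinarith
  have := hmono self_mem_Ici (mem_Ici.2 hz) hz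
  simpa [effectivePotential] using this

/-- It vanishes at `z = -1`. At a soft left edge `edgeFactor` is zero at `m - h`, hence nonpositive
further left, and the derivative is nonpositive. For `α > 0` the path stays to the right of the
origin, away from the pole. -/
lemma effectivePotential_nonneg_left {z : ℝ} (hz : z ≤ -1)
    (hy : 0 < α → 0 < m + h / 2 * (z + z⁻¹)) (hφ : m - α * q / (m - h) = 0) :
    0 ≤ effectivePotential α m h r z := by
  have hh := E.h_pos
  have hmonoy : ∀ s t : ℝ, s ≤ t → t ≤ -1 → s + s⁻¹ ≤ t + t⁻¹ := fun s t hst ht => by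
    have hs0 : s < 0 := by linarith
    have ht0 : t < 0 := by linarith
    have : t + t⁻¹ - (s + s⁻¹) = (t - s) * (s * t - 1) / (s * t) := by
      have := hs0.ne; have := ht0.ne
      field_simp; ring
    have h1 : 1 ≤ s * t := by nlinarith
    have : 0 ≤ (t - s) * (s * t - 1) / (s * t) :=
      div_nonneg (mul_nonneg (by linarith) (by linarith)) (by linarith)
    linarith
  have hle : ∀ t : ℝ, t ≤ -1 → m + h / 2 * (t + t⁻¹) ≤ m - h := fun t ht => by
    have := hmonoy t (-1) ht le_rfl
    norm_num at this
    nlinarith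
  have hpos : ∀ t : ℝ, z ≤ t → t ≤ -1 → 0 < α → 0 < m + h / 2 * (t + t⁻¹) :=
    fun t h1 h2 hα => by
      have := hmonoy z t h1 h2
      have := hy hα
      nlinarith
  have hd : ∀ t : ℝ, z ≤ t → t ≤ -1 → HasDerivAt (effectivePotential α m h r) _ t :=
    fun t h1 h2 => E.hasDerivAt_effectivePotential (by linarith) fun hα => (hpos t h1 h2 hα).ne'
  have hanti : AntitoneOn (effectivePotential α m h r) (Icc z (-1)) := by
    refine antitoneOn_of_deriv_nonpos (convex_Icc z (-1))
      (fun t ht => (hd t ht.1 ht.2).continuousAt.continuousWithinAt)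
      (fun t ht => (hd t (interior_subset ht).1
        (interior_subset ht).2).differentiableAt.differentiableWithinAt)
      fun t ht => ?_
    have ht : t ∈ Icc z (-1) := interior_subset ht
    rw [(hd t ht.1 ht.2).deriv]
    have h1 := hle t ht.2
    have h2 := E.edgeFactor_mono (hpos t ht.1 ht.2) h1
    rw [edgeFactor_left, hφ] at h2
    refine div_nonpos_of_nonneg_of_nonpos ?_ (by linarith [ht.2])
    nlinarith
  have := hanti (left_mem_Icc.2 hz) (right_mem_Icc.2 hz) hz
  refine le_trans (le_of_eq ?_) this
  simp [effectivePotential]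

end EdgeData

end LogEquilibrium

/-! ### Verification of the Euler-Lagrange conditions. -/

namespace LogEquilibrium

open MeasureTheory Set Filter Topology Complex Metric

/-- The equilibrium measure attached to an `EdgeData`. -/
noncomputable def edgeMeasure (α m h r : ℝ) : Measure ℝ :=
  arcMeasure m h (angleWeight (-(m * h)) (-(h ^ 2 / 2)) (-α) r)

/-- The value of the effective potential on the support. -/
noncomputable def robinConstant (α m h r : ℝ) : ℝ :=
  m ^ 2 / 2 + h ^ 2 / 4 - Real.log (h / 2) - α * Real.log (h / (2 * r))

/-- With `u = (y - m) / h`, solve `z + z⁻¹ = 2 u`: by an angle if `|u| ≤ 1`, otherwise by the real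
root `u ± √(u² - 1)` of modulus at least `1`. -/
lemma exists_joukowski (m : ℝ) {h : ℝ} (hh : 0 < h) (y : ℝ) :
    (∃ φ, y = m + h * Real.cos φ) ∨ (∃ z : ℝ, 1 ≤ z ∧ y = m + h / 2 * (z + z⁻¹)) ∨
      (y < m - h ∧ ∃ z : ℝ, z ≤ -1 ∧ y = m + h / 2 * (z + z⁻¹)) := by
  set u := (y - m) / h with hu
  have hy : y = m + h * u := by rw [hu]; field_simp; ring
  rcases lt_or_ge u (-1) with h1 | h1
  · right; right
    have hs : 0 ≤ u ^ 2 - 1 := by nlinarith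
    have hsq := Real.sq_sqrt hs
    have hinv : (u - √(u ^ 2 - 1))⁻¹ = u + √(u ^ 2 - 1) := by
      rw [inv_eq_iff_eq_inv, ← one_div, eq_div_iff]
      · nlinarith
      · intro h0; nlinarith
    refine ⟨by nlinarith, u - √(u ^ 2 - 1), by linarith [Real.sqrt_nonneg (u ^ 2 - 1)], ?_⟩
    rw [hinv, hy]; ring
  rcases lt_or_ge 1 u with h2 | h2
  · right; left
    have hs : 0 ≤ u ^ 2 - 1 := by nlinarith
    have hsq := Real.sq_sqrt hs
    have hinv : (u + √(u ^ 2 - 1))⁻¹ = u - √(u ^ 2 - 1) := by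
      rw [inv_eq_iff_eq_inv, ← one_div, eq_div_iff]
      · nlinarith
      · intro h0; nlinarith
    refine ⟨u + √(u ^ 2 - 1), by linarith [Real.sqrt_nonneg (u ^ 2 - 1)], ?_⟩
    rw [hinv, hy]; ring
  · left
    exact ⟨Real.arccos u, by rw [Real.cos_arccos h1 h2, hy]⟩

lemma exists_complex_joukowski (m : ℝ) {h : ℝ} (hh : 0 < h) (y : ℝ) :
    ∃ z : ℂ, 1 ≤ ‖z‖ ∧ (y : ℂ) = m + h / 2 * (z + z⁻¹) := by
  rcases exists_joukowski m hh y with ⟨φ, rfl⟩ | ⟨z, hz, rfl⟩ | ⟨-, z, hz, rfl⟩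
  · refine ⟨circleMap 0 1 φ, by simp, ?_⟩
    have := cos_nat_mul_eq 1 φ
    simp only [Nat.cast_one, one_mul, pow_one] at this
    rw [ofReal_add, ofReal_mul, this]; ring
  · refine ⟨z, ?_, by push_cast; rfl⟩
    rw [norm_real, Real.norm_eq_abs]; exact hz.trans (le_abs_self z)
  · refine ⟨z, ?_, by push_cast; rfl⟩
    rw [norm_real, Real.norm_eq_abs]; linarith [neg_le_abs z]

namespace EdgeData

variable {α m h r p q : ℝ} (E : EdgeData α m h r p q)
include E

lemma potential {z : ℂ} (hz : 1 ≤ ‖z‖) {y : ℝ} (hy : (y : ℂ) = m + h / 2 * (z + z⁻¹)) :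
    Integrable (fun x => Real.log |y - x|) (edgeMeasure α m h r) ∧
    ∫ x, Real.log |y - x| ∂edgeMeasure α m h r = Real.log (h / 2) + Real.log ‖z‖ +
      m * h * (z⁻¹).re + h ^ 2 / 4 * ((z ^ 2)⁻¹).re - 2 * α * Real.log ‖1 + r / z‖ := by
  obtain ⟨h1, h2⟩ := potential_arcMeasure E.r_nonneg E.r_lt_one E.angleWeight_nonneg E.h_pos hz hy
  refine ⟨h1, h2.trans ?_⟩
  rw [circlePotential]; ring

/-- Splits the logarithm of the field along the factorisation of `y`; for `α = 0` both sides are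
zero, whatever `r` is. -/
lemma log_field {y A B : ℝ} (hA : 0 < α → A ≠ 0) (hB : 0 < α → B ≠ 0)
    (hfac : 0 < α → 2 * r * y = h * (A * B)) :
    α * Real.log (1 / y) = -(α * (Real.log (h / (2 * r)) + Real.log A + Real.log B)) := by
  rcases E.alpha_nonneg.eq_or_lt with h0 | hα
  · rw [← h0]; simp
  · rcases E.origin with h0 | ⟨hr, -⟩
    · exact absurd h0 hα.ne'
    have hh := E.h_pos
    have : y = h / (2 * r) * A * B := by
      have := hfac hα
      field_simp
      linarith
    rw [one_div, Real.log_inv, this, Real.log_mul (mul_ne_zero (by positivity) (hA hα)) (hB hα),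
      Real.log_mul (by positivity) (hA hα)]
    ring

/-- On the unit circle the terms in `cos φ`, `cos (2 φ)` and `log ‖1 + r / z‖` of the potential
equal those of half the field; this is what fixes the coefficients of the weight. -/
lemma variational_eq (φ : ℝ) :
    realField α (m + h * Real.cos φ) / 2 -
      ∫ x, Real.log |m + h * Real.cos φ - x| ∂edgeMeasure α m h r = robinConstant α m h r := by
  have hcos := cos_nat_mul_eq 1 φ
  simp only [Nat.cast_one, one_mul, pow_one] at hcos
  have hz : ‖circleMap 0 1 φ‖ = 1 := by simp
  have hJ : ((m + h * Real.cos φ : ℝ) : ℂ) =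
      m + h / 2 * (circleMap 0 1 φ + (circleMap 0 1 φ)⁻¹) := by
    rw [ofReal_add, ofReal_mul, hcos]; ring
  have hinv : (circleMap 0 1 φ)⁻¹ = circleMap 0 1 (-φ) := by rw [circleMap_zero_inv, inv_one]
  have hsq : (circleMap 0 1 φ ^ 2)⁻¹ = circleMap 0 1 (-(2 * φ)) := by
    have := circleMap_zero_inv 1 (2 * φ)
    rw [inv_one] at this
    rw [← this, circleMap_zero, circleMap_zero, ofReal_one, one_mul, one_mul, ← Complex.exp_nat_mul]
    push_cast; ring_nf
  have hre : ∀ t : ℝ, (circleMap 0 1 t).re = Real.cos t := fun t => by simp [circleMap]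
  have him : ∀ t : ℝ, (circleMap 0 1 t).im = Real.sin t := fun t => by simp [circleMap]
  have hnormsq : ‖1 + r / circleMap 0 1 φ‖ ^ 2 = 1 + r ^ 2 + 2 * r * Real.cos φ := by
    rw [div_eq_mul_inv, hinv, ← normSq_eq_norm_sq, normSq_apply, add_re, add_im, re_ofReal_mul,
      im_ofReal_mul, hre, him, Real.cos_neg, Real.sin_neg, one_re, one_im]
    nlinarith [Real.sin_sq_add_cos_sq φ]
  have hne : ‖1 + r / circleMap 0 1 φ‖ ≠ 0 :=
    norm_ne_zero_iff.2 (one_add_div_ne_zero E.r_nonneg E.r_lt_one hz.ge)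
  rw [(E.potential hz.ge hJ).2, hz, hinv, hsq, hre, hre, Real.cos_neg, Real.cos_neg, realField]
  have hlog := E.log_field (y := m + h * Real.cos φ) (A := ‖1 + r / circleMap 0 1 φ‖)
    (B := ‖1 + r / circleMap 0 1 φ‖)
    (fun _ => hne) (fun _ => hne) (fun hα => by
      rw [← sq, hnormsq]
      rcases E.origin with h0 | ⟨hr, h1, h2, h3⟩
      · exact absurd h0 hα.ne'
      · linear_combination h1)
  rw [robinConstant, Real.cos_two_mul, Real.log_one]
  linear_combination hlog

lemma variational_real {z y : ℝ} (hz : 1 ≤ |z|) (hy : y = m + h / 2 * (z + z⁻¹))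
    (hy0 : 0 < α → 0 < y) :
    realField α y / 2 - ∫ x, Real.log |y - x| ∂edgeMeasure α m h r =
      robinConstant α m h r + effectivePotential α m h r z := by
  have hz0 : z ≠ 0 := by rintro rfl; simp at hz; linarith
  have hz' : 1 ≤ ‖(z : ℂ)‖ := by rwa [norm_real, Real.norm_eq_abs]
  have hfac : 0 < α → 2 * r * y = h * ((1 + r * z) * (1 + r * z⁻¹)) := fun hα => by
    rw [hy]; exact E.joukowski_factor hα hz0
  have hne : 0 < α → h * ((1 + r * z) * (1 + r * z⁻¹)) ≠ 0 := fun hα => by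
    rw [← hfac hα]
    rcases E.origin with h0 | ⟨hr, -⟩
    · exact absurd h0 hα.ne'
    · exact mul_ne_zero (by positivity) (hy0 hα).ne'
  have hlog := E.log_field (fun hα h' => hne hα (by rw [h']; ring))
    (fun hα h' => hne hα (by rw [h']; ring)) hfac
  have hnorm : ‖1 + (r : ℂ) / z‖ = |1 + r * z⁻¹| := by
    rw [← Real.norm_eq_abs, ← norm_real]; push_cast; rw [div_eq_mul_inv]
  rw [(E.potential hz' (by rw [hy]; push_cast; rfl)).2, hnorm, norm_real, Real.norm_eq_abs,
    Real.log_abs, Real.log_abs, ← ofReal_pow, ← ofReal_inv, ← ofReal_inv, ofReal_re, ofReal_re,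
    realField, robinConstant, effectivePotential]
  have hsq : y ^ 2 = m ^ 2 + m * h * (z + z⁻¹) + h ^ 2 / 4 * (z ^ 2 + 2 + (z ^ 2)⁻¹) := by
    rw [hy]; field_simp; ring
  rw [hsq, inv_pow]
  linear_combination hlog

/-- The measure attached to an `EdgeData` is the equilibrium measure on every set that contains
the support, and that meets the left of the support only if the left end point is soft. -/
theorem isEquilibriumMeasure {S : Set ℝ} (hS0 : 0 < α → S ⊆ Ici 0)
    (hS : Ioo (m - h) (m + h) ⊆ S) (hleft : ∀ x ∈ S, x < m - h → m - α * q / (m - h) = 0)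
    [NullSingletonClass (edgeMeasure α m h r)] :
    IsEquilibriumMeasure (extField α) S (edgeMeasure α m h r) := by
  have hh := E.h_pos
  have hprob : IsProbabilityMeasure (edgeMeasure α m h r) :=
    isProbabilityMeasure_arcMeasure E.r_nonneg E.r_lt_one E.angleWeight_nonneg
  have hmem : ∀ᵐ x ∂edgeMeasure α m h r, x ∈ Ioo (m - h) (m + h) := ae_arcMeasure_mem hh
  -- The lower bound `C` comes from the explicit potential with `‖z‖ ≥ 1`: `log ‖z‖ ≥ 0`, the real
  -- parts of `z⁻¹` and `(z ^ 2)⁻¹` are at most `1` in modulus, and `‖1 + r / z‖ ≤ 2`.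
  refine isEquilibriumMeasure_of_variational (c := robinConstant α m h r)
    (C := Real.log (h / 2) - |m * h| - h ^ 2 / 4 - 2 * α * Real.log 2) E.alpha_nonneg hS0
    ?_ ?_ ?_ ?_ ?_ ?_
  · exact measure_eq_zero_iff_ae_notMem.2 (hmem.mono fun x hx hx' => hx' (hS hx))
  · have hcont : ContinuousOn (realField α) (Icc (m - h) (m + h)) := by
      unfold realField
      rcases E.alpha_nonneg.eq_or_lt with h0 | hα
      · rw [← h0]; simp only [mul_zero, zero_mul, add_zero]; fun_prop
      · refine ContinuousOn.add (by fun_prop) (ContinuousOn.mul (by fun_prop) ?_)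
        have : ∀ x ∈ Icc (m - h) (m + h), x ≠ 0 := fun x hx => (E.field_pos hα hx.1).ne'
        exact ContinuousOn.log (continuousOn_const.div continuousOn_id this)
          fun x hx => one_div_ne_zero (this x hx)
    obtain ⟨M, hM⟩ := isCompact_Icc.exists_bound_of_continuousOn hcont
    exact Integrable.of_bound (measurable_realField α).aestronglyMeasurable M
      (hmem.mono fun x hx => hM x (Ioo_subset_Icc_self hx))
  · intro y _
    obtain ⟨z, hz, hy⟩ := exists_complex_joukowski m hh y
    exact (E.potential hz hy).1
  · intro y _
    obtain ⟨z, hz, hy⟩ := exists_complex_joukowski m hh y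
    rw [(E.potential hz hy).2]
    have hz0 : 0 < ‖z‖ := by linarith
    have h1 : 0 ≤ Real.log ‖z‖ := Real.log_nonneg hz
    have h2 : ‖z⁻¹‖ ≤ 1 := by rw [norm_inv]; exact inv_le_one_of_one_le₀ hz
    have h3 : ‖(z ^ 2)⁻¹‖ ≤ 1 := by
      rw [norm_inv, norm_pow]; exact inv_le_one_of_one_le₀ (one_le_pow₀ hz)
    have h4 := (abs_re_le_norm z⁻¹).trans h2
    have h5 := (abs_le.1 ((abs_re_le_norm (z ^ 2)⁻¹).trans h3)).1
    have h6 : -|m * h| ≤ m * h * (z⁻¹).re := by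
      have : |m * h * (z⁻¹).re| ≤ |m * h| := by
        rw [abs_mul]; exact mul_le_of_le_one_right (abs_nonneg _) h4
      linarith [neg_abs_le (m * h * (z⁻¹).re)]
    have h7 : Real.log ‖1 + r / z‖ ≤ Real.log 2 := by
      refine Real.log_le_log (norm_pos_iff.2 (one_add_div_ne_zero E.r_nonneg E.r_lt_one hz)) ?_
      refine (norm_add_le _ _).trans ?_
      rw [norm_one, norm_div, norm_real, Real.norm_eq_abs, abs_of_nonneg E.r_nonneg]
      have : r / ‖z‖ ≤ 1 := (div_le_one hz0).2 (E.r_lt_one.le.trans hz)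
      linarith
    have h8 := mul_le_mul_of_nonneg_left h7 (mul_nonneg zero_le_two E.alpha_nonneg)
    have h9 : -(h ^ 2 / 4) ≤ h ^ 2 / 4 * ((z ^ 2)⁻¹).re := by nlinarith [sq_nonneg h]
    linarith
  · intro y hyS hy0
    have hypos : 0 < α → 0 < y := fun hα => lt_of_le_of_ne (hS0 hα hyS) (hy0 hα).symm
    rcases exists_joukowski m hh y with ⟨φ, rfl⟩ | ⟨z, hz, hy⟩ | ⟨hym, z, hz, hy⟩
    · exact (E.variational_eq φ).ge
    · rw [E.variational_real (hz.trans (le_abs_self z)) hy hypos]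
      linarith [E.effectivePotential_nonneg_right hz]
    · rw [E.variational_real (by linarith [neg_le_abs z]) hy hypos]
      linarith [E.effectivePotential_nonneg_left hz (fun hα => by rw [← hy]; exact hypos hα)
        (hleft y hyS hym)]
  · filter_upwards [hmem] with y hy
    rw [← image_add_mul_cos m hh] at hy
    obtain ⟨φ, -, rfl⟩ := hy
    exact E.variational_eq φ

end EdgeData

end LogEquilibrium

/-! ### The explicit densities and their equilibrium property. -/

namespace LogEquilibrium

open MeasureTheory Set Filter Topology

lemma support_densityMeasure {a b : ℝ} (hab : a < b) {T : Set ℝ} (hTm : MeasurableSet T)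
    (hT1 : Ioo a b ⊆ T) (hT2 : T ⊆ Icc a b) {f : ℝ → ℝ} (hf : Measurable f)
    (hpos : ∀ x ∈ Ioo a b, 0 < f x) : (densityMeasure T f).support = Icc a b := by
  refine subset_antisymm ?_ ?_
  · refine Measure.support_subset_of_isClosed isClosed_Icc ?_
    have : ∀ᵐ x ∂densityMeasure T f, x ∈ T :=
      (withDensity_absolutelyContinuous _ _).ae_le (ae_restrict_mem hTm)
    filter_upwards [this] with x hx using hT2 hx
  · rw [← closure_Ioo hab.ne]
    refine closure_minimal (fun x hx => ?_) Measure.isClosed_support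
    rw [Measure.mem_support_iff_forall]
    intro U hU
    obtain ⟨V, hVU, hV, hxV⟩ := mem_nhds_iff.1 hU
    refine lt_of_lt_of_le ?_ (measure_mono (inter_subset_left.trans hVU : V ∩ Ioo a b ⊆ U))
    have hVm : MeasurableSet (V ∩ Ioo a b) := hV.measurableSet.inter measurableSet_Ioo
    rw [densityMeasure, withDensity_apply _ hVm, Measure.restrict_restrict hVm,
      inter_eq_self_of_subset_left (inter_subset_right.trans hT1),
      setLIntegral_pos_iff hf.ennreal_ofReal]
    have : Function.support (fun x => ENNReal.ofReal (f x)) ∩ (V ∩ Ioo a b) = V ∩ Ioo a b :=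
      inter_eq_self_of_subset_right fun y hy => by simpa using hpos y hy.2
    rw [this]
    exact (hV.inter isOpen_Ioo).measure_pos _ ⟨x, hxV, hx⟩

instance (T : Set ℝ) (f : ℝ → ℝ) : NullSingletonClass (densityMeasure T f) := by
  unfold densityMeasure; infer_instance

lemma measurable_hardDensity (α σ b : ℝ) : Measurable (hardDensity α σ b) := by
  unfold hardDensity; fun_prop

lemma measurable_softDensity (α a b : ℝ) : Measurable (softDensity α a b) := by
  unfold softDensity; fun_prop

/-- The equilibrium data of an interval `[a, b]`. -/
lemma exists_edgeData {α a b : ℝ} (hα : 0 ≤ α) (hab : a < b) (ha : 0 < α → 0 < a)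
    (hφ : 0 ≤ phi α b a) (hψ : psi α b a = 0) :
    ∃ r, EdgeData α ((a + b) / 2) ((b - a) / 2) r √(a * b) √(a / b) := by
  have hψ' : 3 * ((b - a) / 2) ^ 2 + 2 * ((a + b) / 2 - (b - a) / 2) * ((b - a) / 2) +
      2 * α * √(a / b) - 2 * α - 2 = 0 := by rw [psi] at hψ; linear_combination hψ
  have hm : (a + b) / 2 - (b - a) / 2 = a := by ring
  rcases hα.eq_or_lt with rfl | hα
  · refine ⟨0, le_rfl, by linarith, le_rfl, one_pos, Real.sqrt_nonneg _, Or.inl rfl, hψ', ?_⟩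
    simp only [phi, mul_zero, zero_div, sub_zero, zero_mul] at hφ ⊢
    linarith
  · have ha := ha hα
    have hb := ha.trans hab
    obtain ⟨s, hs, rfl⟩ : ∃ s, 0 < s ∧ a = s ^ 2 :=
      ⟨√a, Real.sqrt_pos.2 ha, (Real.sq_sqrt ha.le).symm⟩
    obtain ⟨t, ht, rfl⟩ : ∃ t, 0 < t ∧ b = t ^ 2 :=
      ⟨√b, Real.sqrt_pos.2 hb, (Real.sq_sqrt hb.le).symm⟩
    have hst : s < t := lt_of_pow_lt_pow_left₀ 2 ht.le hab
    have hp : √(s ^ 2 * t ^ 2) = s * t := by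
      rw [← mul_pow, Real.sqrt_sq (mul_pos hs ht).le]
    have hq : √(s ^ 2 / t ^ 2) = s / t := by
      rw [← div_pow, Real.sqrt_sq (div_pos hs ht).le]
    have hsum : 0 < t + s := by linarith
    rw [hq] at hψ'
    rw [phi, hp] at hφ
    rw [hp, hq]
    -- This `r = (√b - √a) / (√b + √a)` is the root in `[0, 1)` of `2 r m = h (1 + r²)`.
    refine ⟨(t - s) / (t + s), hα.le, by linarith, div_nonneg (by linarith) hsum.le,
      (div_lt_one hsum).2 (by linarith), (div_pos hs ht).le, Or.inr ⟨div_pos (by linarith) hsum,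
      ?_, ?_, ?_⟩, hψ', ?_⟩
    · field_simp; ring
    · field_simp; ring
    · field_simp; ring
    · rw [hm]
      have : α * (s / t) / s ^ 2 = 2 * α / (s * t) / 2 := by field_simp
      rw [this]; linarith

lemma hardDensity_eq (α a b x : ℝ) :
    hardDensity α a b x = 1 / Real.pi * √((b - x) / (x - a)) *
      edgeFactor α ((b - a) / 2) √(a / b) x := by
  rw [hardDensity, edgeFactor]
  have := Real.pi_ne_zero
  field_simp
  ring

/-- When `phi` vanishes the factor has a zero at `a`. It turns the hard-edge root `√((b - x) / (x -
a))` into the soft-edge root `√((b - x) (x - a))`. -/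
lemma edgeFactor_of_phi_eq_zero {α a b x : ℝ} (hα : 0 ≤ α) (hab : a < b) (ha : 0 < α → 0 < a)
    (hφ : phi α b a = 0) (hx : 0 < α → x ≠ 0) :
    edgeFactor α ((b - a) / 2) √(a / b) x = (x - a) * (1 + α / √(a * b) * (1 / x)) := by
  rcases hα.eq_or_lt with rfl | hα
  · simp only [phi, mul_zero, zero_div, sub_zero] at hφ
    simp only [edgeFactor, zero_mul, zero_div]
    linarith
  · have ha := ha hα
    have hx := hx hα
    have hb := ha.trans hab
    obtain ⟨s, hs, rfl⟩ : ∃ s, 0 < s ∧ a = s ^ 2 :=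
      ⟨√a, Real.sqrt_pos.2 ha, (Real.sq_sqrt ha.le).symm⟩
    obtain ⟨t, ht, rfl⟩ : ∃ t, 0 < t ∧ b = t ^ 2 :=
      ⟨√b, Real.sqrt_pos.2 hb, (Real.sq_sqrt hb.le).symm⟩
    have hp : √(s ^ 2 * t ^ 2) = s * t := by
      rw [← mul_pow, Real.sqrt_sq (mul_pos hs ht).le]
    have hq : √(s ^ 2 / t ^ 2) = s / t := by
      rw [← div_pow, Real.sqrt_sq (div_pos hs ht).le]
    rw [phi, hp] at hφ
    rw [edgeFactor, hp, hq]
    field_simp at hφ ⊢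
    linear_combination x * hφ

lemma softDensity_nonneg {α a b x : ℝ} (hα : 0 ≤ α) (ha : 0 < α → 0 < a) (hx : a ≤ x) :
    0 ≤ softDensity α a b x := by
  have : 0 ≤ α / √(a * b) * (1 / x) := by
    rcases hα.eq_or_lt with rfl | hα
    · simp
    · have hx := (ha hα).trans_le hx
      positivity
  have := Real.pi_pos
  unfold softDensity
  positivity

lemma softDensity_pos {α a b x : ℝ} (hα : 0 ≤ α) (ha : 0 < α → 0 < a) (hx : x ∈ Ioo a b) :
    0 < softDensity α a b x := by
  have : 0 ≤ α / √(a * b) * (1 / x) := by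
    rcases hα.eq_or_lt with rfl | hα
    · simp
    · have hx := (ha hα).trans hx.1
      positivity
  have h2 : 0 < (b - x) * (x - a) := mul_pos (sub_pos.2 hx.2) (sub_pos.2 hx.1)
  have := Real.pi_pos
  unfold softDensity
  positivity

lemma support_softDensity {α a b : ℝ} (hα : 0 ≤ α) (hab : a < b) (ha : 0 < α → 0 < a) :
    (densityMeasure (Icc a b) (softDensity α a b)).support = Icc a b :=
  support_densityMeasure hab measurableSet_Icc Ioo_subset_Icc_self subset_rfl
    (measurable_softDensity α a b) fun _ hx => softDensity_pos hα ha hx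

section Hard

variable {α a b : ℝ} (hα : 0 ≤ α) (hab : a < b) (ha : 0 < α → 0 < a) (hφ : 0 ≤ phi α b a)
  (hψ : psi α b a = 0)
include hα hab ha hφ hψ

lemma edgeFactor_ge_sub {x : ℝ} (hx : a ≤ x) :
    x - a ≤ edgeFactor α ((b - a) / 2) √(a / b) x := by
  obtain ⟨r, E⟩ := exists_edgeData hα hab ha hφ hψ
  have := E.edgeFactor_ge (x := x) (by linarith)
  linarith

lemma hardDensity_nonneg {x : ℝ} (hx : x ∈ Ioc a b) : 0 ≤ hardDensity α a b x := by
  have h1 := edgeFactor_ge_sub hα hab ha hφ hψ hx.1.le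
  rw [hardDensity_eq]
  have := Real.pi_pos
  have h2 : 0 ≤ edgeFactor α ((b - a) / 2) √(a / b) x := by linarith [hx.1]
  positivity

lemma support_hardDensity :
    (densityMeasure (Ioc a b) (hardDensity α a b)).support = Icc a b := by
  refine support_densityMeasure hab measurableSet_Ioc Ioo_subset_Ioc_self Ioc_subset_Icc_self
    (measurable_hardDensity α a b) fun x hx => ?_
  have h1 := edgeFactor_ge_sub hα hab ha hφ hψ hx.1.le
  rw [hardDensity_eq]
  have := Real.pi_pos
  have h2 : 0 < edgeFactor α ((b - a) / 2) √(a / b) x := by linarith [hx.1]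
  have h3 : 0 < (b - x) / (x - a) := div_pos (sub_pos.2 hx.2) (sub_pos.2 hx.1)
  positivity

lemma isEquilibriumMeasure_hardDensity :
    IsEquilibriumMeasure (extField α) (Ici a) (densityMeasure (Ioc a b) (hardDensity α a b)) := by
  obtain ⟨r, E⟩ := exists_edgeData hα hab ha hφ hψ
  have hh := E.h_pos
  have heq : densityMeasure (Ioc a b) (hardDensity α a b) =
      edgeMeasure α ((a + b) / 2) ((b - a) / 2) r := by
    refine densityMeasure_eq_arcMeasure hab Ioo_subset_Ioc_self Ioc_subset_Icc_self fun θ hθ => ?_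
    rw [E.angleWeight_eq, hardDensity_eq]
    have hs : 0 < Real.sin θ := Real.sin_pos_of_mem_Ioo hθ
    have hsc := Real.sin_sq_add_cos_sq θ
    have hc2 : 0 < 1 + Real.cos θ := by nlinarith [Real.neg_one_le_cos θ]
    have hc1 : 0 ≤ 1 - Real.cos θ := by linarith [Real.cos_le_one θ]
    -- The half-angle identity `(1 - cos θ) / (1 + cos θ) = ((1 - cos θ) / sin θ)²`.
    have hsqrt : √((b - ((a + b) / 2 + (b - a) / 2 * Real.cos θ)) /
        ((a + b) / 2 + (b - a) / 2 * Real.cos θ - a)) = (1 - Real.cos θ) / Real.sin θ := by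
      have h1 : (b - ((a + b) / 2 + (b - a) / 2 * Real.cos θ)) /
          ((a + b) / 2 + (b - a) / 2 * Real.cos θ - a) = ((1 - Real.cos θ) / Real.sin θ) ^ 2 := by
        rw [div_pow, div_eq_div_iff _ (pow_pos hs 2).ne']
        · linear_combination (b - a) / 2 * (1 - Real.cos θ) * hsc
        · have : (a + b) / 2 + (b - a) / 2 * Real.cos θ - a =
            (b - a) / 2 * (1 + Real.cos θ) := by ring
          rw [this]; exact (mul_pos hh hc2).ne'
      rw [h1, Real.sqrt_sq (div_nonneg hc1 hs.le)]
    rw [hsqrt]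
    field_simp
    ring
  have : NullSingletonClass (edgeMeasure α ((a + b) / 2) ((b - a) / 2) r) := by
    rw [← heq]; infer_instance
  rw [heq]
  refine E.isEquilibriumMeasure (fun hα => Ici_subset_Ici.2 (ha hα).le) ?_ ?_
  · intro x hx
    exact (by linarith [hx.1] : a ≤ x)
  · intro x (hx : a ≤ x) hx'
    linarith

end Hard

lemma isEquilibriumMeasure_softDensity {α a b σ : ℝ} (hα : 0 ≤ α) (hab : a < b)
    (ha : 0 < α → 0 < a) (hφ : phi α b a = 0) (hψ : psi α b a = 0) (hσ : σ ≤ a)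
    (hσ0 : 0 < α → 0 ≤ σ) :
    IsEquilibriumMeasure (extField α) (Ici σ) (densityMeasure (Icc a b) (softDensity α a b)) := by
  obtain ⟨r, E⟩ := exists_edgeData hα hab ha hφ.ge hψ
  have hh := E.h_pos
  have heq : densityMeasure (Icc a b) (softDensity α a b) =
      edgeMeasure α ((a + b) / 2) ((b - a) / 2) r := by
    refine densityMeasure_eq_arcMeasure hab Ioo_subset_Icc_self subset_rfl fun θ hθ => ?_
    have hs : 0 < Real.sin θ := Real.sin_pos_of_mem_Ioo hθ
    have hsc := Real.sin_sq_add_cos_sq θ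
    have hx : a ≤ (a + b) / 2 + (b - a) / 2 * Real.cos θ := by
      nlinarith [Real.neg_one_le_cos θ]
    have hsqrt : √((b - ((a + b) / 2 + (b - a) / 2 * Real.cos θ)) *
        ((a + b) / 2 + (b - a) / 2 * Real.cos θ - a)) = (b - a) / 2 * Real.sin θ := by
      rw [← Real.sqrt_sq (mul_pos hh hs).le]
      congr 1
      linear_combination (-((b - a) / 2) ^ 2) * hsc
    rw [E.angleWeight_eq, edgeFactor_of_phi_eq_zero hα hab ha hφ
      (fun hα => ((ha hα).trans_le hx).ne'), softDensity, hsqrt]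
    have := Real.pi_ne_zero
    rw [eq_div_iff this]
    have h2 : (b - a) / 2 * Real.sin θ * (1 / Real.pi * ((b - a) / 2 * Real.sin θ) *
        (1 + α / √(a * b) * (1 / ((a + b) / 2 + (b - a) / 2 * Real.cos θ)))) * Real.pi =
        ((b - a) / 2) ^ 2 * (Real.sin θ) ^ 2 *
        (1 + α / √(a * b) * (1 / ((a + b) / 2 + (b - a) / 2 * Real.cos θ))) := by
      rw [one_div Real.pi]
      field_simp
    rw [h2]
    have h3 : Real.sin θ ^ 2 = 1 - Real.cos θ ^ 2 := by linarith
    rw [h3]; ring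
  have : NullSingletonClass (edgeMeasure α ((a + b) / 2) ((b - a) / 2) r) := by
    rw [← heq]; infer_instance
  rw [heq]
  refine E.isEquilibriumMeasure (fun hα x hx => (hσ0 hα).trans hx) ?_ ?_
  · intro x hx
    exact (by linarith [hx.1] : σ ≤ x)
  · intro x _ _
    rw [show (a + b) / 2 - (b - a) / 2 = a by ring]
    -- The soft-edge condition is the factorisation evaluated at its zero `x = a`.
    have h0 := edgeFactor_of_phi_eq_zero hα hab ha hφ (x := a) (fun hα => (ha hα).ne')
    rw [sub_self, zero_mul, edgeFactor] at h0
    linarith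

end LogEquilibrium

/-! ### The equations for the end points. -/

namespace LogEquilibrium

open MeasureTheory Set Filter Topology

lemma exists_sq_eq {x : ℝ} (hx : 0 < x) : ∃ s, 0 < s ∧ x = s ^ 2 :=
  ⟨√x, Real.sqrt_pos.2 hx, (Real.sq_sqrt hx.le).symm⟩

lemma sqrt_sq_mul_sq {s t : ℝ} (hs : 0 < s) (ht : 0 < t) : √(s ^ 2 * t ^ 2) = s * t := by
  rw [← mul_pow, Real.sqrt_sq (mul_pos hs ht).le]

lemma sqrt_sq_div_sq {s t : ℝ} (hs : 0 < s) (ht : 0 < t) : √(s ^ 2 / t ^ 2) = s / t := by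
  rw [← div_pow, Real.sqrt_sq (div_pos hs ht).le]

lemma phi_eq_zero_iff {α a b : ℝ} (ha : 0 < a) (hb : 0 < b) :
    phi α b a = 0 ↔ (a + b) * √(a * b) = 2 * α := by
  have : 0 < √(a * b) := Real.sqrt_pos.2 (mul_pos ha hb)
  rw [phi, sub_eq_zero, eq_div_iff this.ne', add_comm b a]

/-- On `phi = 0` one has `2 α √(a / b) = a (a + b)`, so `psi` becomes a polynomial in `a + b` and `a
b`. -/
lemma psi_of_phi_eq_zero {α a b : ℝ} (ha : 0 < a) (hb : 0 < b) (hφ : phi α b a = 0) :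
    psi α b a = 3 / 4 * (a + b) ^ 2 - a * b - 2 * (α + 1) := by
  rw [phi_eq_zero_iff ha hb] at hφ
  obtain ⟨s, hs, rfl⟩ := exists_sq_eq ha
  obtain ⟨t, ht, rfl⟩ := exists_sq_eq hb
  rw [sqrt_sq_mul_sq hs ht] at hφ
  rw [psi, sqrt_sq_div_sq hs ht, ← hφ]
  field_simp
  linear_combination -4 * hφ

lemma phi_lt_phi {α a x y : ℝ} (hα : 0 ≤ α) (ha : 0 < a) (hx : 0 < x) (hxy : x < y) :
    phi α x a < phi α y a := by
  have h : √(a * x) ≤ √(a * y) := Real.sqrt_le_sqrt (by nlinarith)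
  have h0 : 0 < √(a * x) := Real.sqrt_pos.2 (mul_pos ha hx)
  have := div_le_div_of_nonneg_left (mul_nonneg zero_le_two hα) h0 h
  unfold phi; linarith

/-- `psi` increases strictly where `phi` is nonnegative. -/
lemma psi_lt_psi {α a x y : ℝ} (ha : 0 < a) (hax : a < x) (hxy : x < y)
    (hφ : 0 ≤ phi α x a) : psi α x a < psi α y a := by
  have hx := ha.trans hax
  have hy := hx.trans hxy
  obtain ⟨s, hs, rfl⟩ := exists_sq_eq ha
  obtain ⟨t, ht, rfl⟩ := exists_sq_eq hx
  obtain ⟨u, hu, rfl⟩ := exists_sq_eq hy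
  have hst : s < t := lt_of_pow_lt_pow_left₀ 2 ht.le hax
  have htu : t < u := lt_of_pow_lt_pow_left₀ 2 hu.le hxy
  rw [phi, sqrt_sq_mul_sq hs ht, sub_nonneg, div_le_iff₀ (mul_pos hs ht)] at hφ
  rw [psi, psi, sqrt_sq_div_sq hs ht, sqrt_sq_div_sq hs hu]
  -- Only the term `2 α √(a / x)` can decrease. The bound `2 α ≤ (x + a) √(a x)` from `phi ≥ 0`
  -- limits the loss, which `h2` shows to be at most the gain of `a (x - a)`.
  have h1 : 2 * α * (s / t) - 2 * α * (s / u) ≤ s ^ 2 * (t ^ 2 + s ^ 2) * (u - t) / u := by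
    have e : 2 * α * (s / t) - 2 * α * (s / u) = 2 * α * (s * (u - t) / (t * u)) := by
      field_simp
    have e2 : s ^ 2 * (t ^ 2 + s ^ 2) * (u - t) / u =
      (t ^ 2 + s ^ 2) * (s * t) * (s * (u - t) / (t * u)) := by field_simp
    rw [e, e2]
    exact mul_le_mul_of_nonneg_right hφ
      (div_nonneg (mul_nonneg hs.le (by linarith)) (mul_pos ht hu).le)
  have h2 : s ^ 2 * (t ^ 2 + s ^ 2) * (u - t) / u ≤ s ^ 2 * (u ^ 2 - t ^ 2) := by
    rw [div_le_iff₀ hu]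
    have h3 : t ^ 2 + s ^ 2 ≤ (u + t) * u := by nlinarith
    have h4 : 0 ≤ s ^ 2 * (u - t) := mul_nonneg (sq_nonneg s) (by linarith)
    nlinarith [mul_le_mul_of_nonneg_left h3 h4]
  have h5 : (t ^ 2 - s ^ 2) ^ 2 < (u ^ 2 - s ^ 2) ^ 2 :=
    pow_lt_pow_left₀ (by linarith) (by linarith) two_ne_zero
  nlinarith

lemma continuousOn_phi {α a : ℝ} (ha : 0 < a) : ContinuousOn (fun x => phi α x a) (Ioi 0) := by
  unfold phi
  refine ContinuousOn.sub (by fun_prop) (ContinuousOn.div (by fun_prop) (by fun_prop) ?_)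
  exact fun x hx => (Real.sqrt_pos.2 (mul_pos ha hx)).ne'

lemma continuousOn_psi {α a : ℝ} : ContinuousOn (fun x => psi α x a) (Ioi 0) := by
  unfold psi
  have : ContinuousOn (fun x : ℝ => a / x) (Ioi 0) :=
    continuousOn_const.div continuousOn_id fun x hx => (mem_Ioi.1 hx).ne'
  fun_prop

/-- Along the curve `s * p = const`, the quantity `3 / 4 * s ^ 2 - p ^ 2` increases with `s`. -/
lemma lt_of_curve_lt {s p s' p' : ℝ} (hp : 0 < p) (hs' : 0 < s') (hp' : 0 < p')
    (h : s * p = s' * p')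
    (hlt : 3 / 4 * s ^ 2 - p ^ 2 < 3 / 4 * s' ^ 2 - p' ^ 2) : s < s' ∧ p' < p := by
  have key : s < s' := by
    by_contra hle
    rw [not_lt] at hle
    have h1 : p ≤ p' := by
      by_contra h2
      rw [not_le] at h2
      nlinarith
    nlinarith
  refine ⟨key, ?_⟩
  by_contra h2
  rw [not_lt] at h2
  nlinarith

/-- The critical equations. -/
structure IsCritical (α a b : ℝ) : Prop where
  pos : 0 < a
  lt : a < b
  phi_eq : phi α b a = 0
  psi_eq : psi α b a = 0

namespace IsCritical

variable {α a b : ℝ}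

lemma curve (C : IsCritical α a b) : (a + b) * √(a * b) = 2 * α :=
  (phi_eq_zero_iff C.pos (C.pos.trans C.lt)).1 C.phi_eq

lemma quadratic (C : IsCritical α a b) : 3 / 4 * (a + b) ^ 2 - a * b = 2 * (α + 1) := by
  have := psi_of_phi_eq_zero C.pos (C.pos.trans C.lt) C.phi_eq
  linarith [C.psi_eq]

/-- By strict AM-GM, `2 √(a b) < a + b`; as the product of `a + b` and `√(a b)` is `2 α`, this gives
`a b < α` and `a + b > 2 √α`, whence `(b - √α) (√α - a) > 0`. -/
lemma lt_sqrt_lt (C : IsCritical α a b) : a < √α ∧ √α < b := by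
  have ha := C.pos
  have hab := C.lt
  have hp : 0 < √(a * b) := Real.sqrt_pos.2 (mul_pos ha (ha.trans hab))
  have hp2 : √(a * b) ^ 2 = a * b := Real.sq_sqrt (mul_pos ha (ha.trans hab)).le
  have hc := C.curve
  have hα : 0 < α := by nlinarith
  have hu : 0 < √α := Real.sqrt_pos.2 hα
  have hu2 : √α ^ 2 = α := Real.sq_sqrt hα.le
  have h1 : 2 * √(a * b) < a + b := by
    refine lt_of_pow_lt_pow_left₀ 2 (by linarith) ?_
    rw [mul_pow, hp2]; nlinarith [pow_pos (sub_pos.2 hab) 2]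
  have h2 : √(a * b) < √α := by
    refine lt_of_pow_lt_pow_left₀ 2 hu.le ?_
    rw [hu2]; nlinarith
  have h3 : 2 * √α < a + b := by
    by_contra h
    rw [not_lt] at h
    nlinarith
  have h4 : 0 < (b - √α) * (√α - a) := by nlinarith
  rcases pos_and_pos_or_neg_and_neg_of_mul_pos h4 with ⟨h5, h6⟩ | ⟨h5, h6⟩
  · exact ⟨by linarith, by linarith⟩
  · linarith

lemma right_eq (C : IsCritical α a b) : b = 2 / 3 * (√(6 * (α + 1) - 2 * a ^ 2) - a / 2) := by
  have h : 6 * (α + 1) - 2 * a ^ 2 = (3 / 2 * b + a / 2) ^ 2 := by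
    linear_combination (-3) * C.quadratic
  rw [h, Real.sqrt_sq (by linarith [C.pos, C.lt])]
  ring

/-- On the hyperbola `s p = 2 α` the quantity `3 / 4 * s ^ 2 - p ^ 2` is strictly increasing in `s`,
so the sum and the product of the end points are determined, and their order tells them apart. -/
lemma unique (C : IsCritical α a b) {a' b' : ℝ} (C' : IsCritical α a' b') : a' = a ∧ b' = b := by
  have ha := C.pos
  have hab := C.lt
  have ha' := C'.pos
  have hab' := C'.lt
  have hp : 0 < √(a * b) := Real.sqrt_pos.2 (mul_pos ha (ha.trans hab))
  have hp2 : √(a * b) ^ 2 = a * b := Real.sq_sqrt (mul_pos ha (ha.trans hab)).le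
  have hp' : 0 < √(a' * b') := Real.sqrt_pos.2 (mul_pos ha' (ha'.trans hab'))
  have hp2' : √(a' * b') ^ 2 = a' * b' := Real.sq_sqrt (mul_pos ha' (ha'.trans hab')).le
  have hc := C.curve
  have hc' := C'.curve
  have hq := C.quadratic
  have hq' := C'.quadratic
  have hs : a' + b' = a + b := by
    rcases lt_trichotomy (a' + b') (a + b) with h | h | h
    · have : √(a * b) < √(a' * b') := by
        by_contra h2; rw [not_lt] at h2; nlinarith
      nlinarith
    · exact h
    · have : √(a' * b') < √(a * b) := by
        by_contra h2; rw [not_lt] at h2; nlinarith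
      nlinarith
  have hprod : a' * b' = a * b := by rw [hs] at hq'; linarith
  have hzero : (a' - a) * (a' - b) = 0 := by linear_combination a' * hs - hprod
  rcases mul_eq_zero.1 hzero with h | h
  · have h1 : a' = a := by linarith
    exact ⟨h1, by linarith⟩
  · linarith

end IsCritical

lemma exists_isCritical {α : ℝ} (hα : 0 < α) : ∃ a b, IsCritical α a b := by
  set D := √((α + 1) ^ 2 + 3 * α ^ 2) with hD
  have hDsq : D ^ 2 = (α + 1) ^ 2 + 3 * α ^ 2 := Real.sq_sqrt (by positivity)
  have hD0 : 0 ≤ D := Real.sqrt_nonneg _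
  -- `t = s²` is the positive root of the quadratic obtained by eliminating `p = 2 α / s`. The
  -- inequality `t > 4 α` is `s > 2 p`, so that `a` and `b`, with sum `s` and product `p²`, are real
  -- and distinct.
  set t := 4 / 3 * (α + 1 + D) with ht
  have ht0 : 0 < t := by positivity
  have hteq : 3 / 4 * t ^ 2 = 2 * (α + 1) * t + 4 * α ^ 2 := by
    rw [ht]; linear_combination 4 / 3 * hDsq
  have ht4 : 4 * α < t := by
    by_contra h; rw [not_lt] at h; nlinarith
  set s := √t with hs
  have hs0 : 0 < s := Real.sqrt_pos.2 ht0
  have hs2 : s ^ 2 = t := Real.sq_sqrt ht0.le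
  set p := 2 * α / s with hp
  have hsp : s * p = 2 * α := by rw [hp]; field_simp
  have hp0 : 0 < p := by positivity
  have h2p : 2 * p < s := by
    by_contra h; rw [not_lt] at h; nlinarith
  set d := √(s ^ 2 - 4 * p ^ 2) with hd
  have hdpos : 0 < s ^ 2 - 4 * p ^ 2 := by nlinarith
  have hd2 : d ^ 2 = s ^ 2 - 4 * p ^ 2 := Real.sq_sqrt hdpos.le
  have hd0 : 0 < d := Real.sqrt_pos.2 hdpos
  have hds : d < s := by
    by_contra h; rw [not_lt] at h; nlinarith
  have hab : (s - d) / 2 * ((s + d) / 2) = p ^ 2 := by linear_combination (-1 / 4) * hd2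
  have hapos : 0 < (s - d) / 2 := by linarith
  have hbpos : 0 < (s + d) / 2 := by linarith
  have hφ : phi α ((s + d) / 2) ((s - d) / 2) = 0 := by
    rw [phi_eq_zero_iff hapos hbpos, hab, Real.sqrt_sq hp0.le]
    linear_combination hsp
  refine ⟨(s - d) / 2, (s + d) / 2, hapos, by linarith, hφ, ?_⟩
  rw [psi_of_phi_eq_zero hapos hbpos hφ, hab]
  have : t * (3 / 4 * s ^ 2 - p ^ 2 - 2 * (α + 1)) = 0 := by
    have : t * p ^ 2 = 4 * α ^ 2 := by
      rw [← hs2]; linear_combination (s * p + 2 * α) * hsp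
    rw [hs2]; linear_combination hteq - this
  rcases mul_eq_zero.1 this with h | h
  · exact absurd h ht0.ne'
  · linear_combination h

/-- For a hard edge to the right of the critical left end point, the right end point exists. -/
lemma exists_right_end {α a b σ : ℝ} (hα : 0 < α) (C : IsCritical α a b) (hσ : a < σ) :
    ∃ x, σ < x ∧ 0 ≤ phi α x σ ∧ psi α x σ = 0 := by
  have hσ0 : 0 < σ := C.pos.trans hσ
  -- A starting point for the intermediate value theorem applied to `psi`: `σ` itself if `phi` is
  -- nonnegative there, otherwise a zero of `phi`. As `phi` increases, it stays nonnegative beyond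
  -- `x₀`.
  have start : ∃ x₀, σ ≤ x₀ ∧ 0 ≤ phi α x₀ σ ∧ psi α x₀ σ ≤ 0 := by
    have hdiag : psi α σ σ = -2 := by
      rw [psi, div_self hσ0.ne', Real.sqrt_one]; ring
    rcases le_or_gt 0 (phi α σ σ) with h | h
    · exact ⟨σ, le_rfl, h, by rw [hdiag]; norm_num⟩
    · have hle : σ ≤ σ + 2 * α / σ := by linarith [div_pos (mul_pos two_pos hα) hσ0]
      have hend : 0 ≤ phi α (σ + 2 * α / σ) σ := by
        have h1 : σ ≤ √(σ * (σ + 2 * α / σ)) := by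
          refine Real.le_sqrt_of_sq_le ?_
          nlinarith
        have h2 := div_le_div_of_nonneg_left (mul_pos two_pos hα).le hσ0 h1
        rw [phi]; linarith
      have hcont : ContinuousOn (fun x => phi α x σ) (Icc σ (σ + 2 * α / σ)) :=
        (continuousOn_phi hσ0).mono fun x hx => hσ0.trans_le hx.1
      obtain ⟨x₀, hx₀, h0⟩ := intermediate_value_Icc hle hcont ⟨h.le, hend⟩
      simp only at h0
      refine ⟨x₀, hx₀.1, h0.ge, ?_⟩
      have hx0 : 0 < x₀ := hσ0.trans_le hx₀.1
      rw [psi_of_phi_eq_zero hσ0 hx0 h0]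
      -- If `psi` were positive at `(x₀, σ)`, this pair would lie further along the hyperbola than
      -- `(a, b)`, with larger sum and smaller product. Then `(b - σ) (b - x₀) < 0` gives `x₀ > b`,
      -- and with `σ > a` the product would exceed `a b`.
      by_contra hcon
      rw [not_le] at hcon
      have hp : 0 < √(a * b) := Real.sqrt_pos.2 (mul_pos C.pos (C.pos.trans C.lt))
      have hp2 : √(a * b) ^ 2 = a * b := Real.sq_sqrt (mul_pos C.pos (C.pos.trans C.lt)).le
      have hp' : 0 < √(σ * x₀) := Real.sqrt_pos.2 (mul_pos hσ0 hx0)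
      have hp2' : √(σ * x₀) ^ 2 = σ * x₀ := Real.sq_sqrt (mul_pos hσ0 hx0).le
      have hq := C.quadratic
      obtain ⟨h1, h2⟩ := lt_of_curve_lt hp (by linarith : 0 < σ + x₀) hp'
        (C.curve.trans ((phi_eq_zero_iff hσ0 hx0).1 h0).symm) (by rw [hp2, hp2']; linarith)
      have h3 : σ * x₀ < a * b := by
        rw [← hp2, ← hp2']; exact pow_lt_pow_left₀ h2 hp'.le two_ne_zero
      have hb : 0 < b := C.pos.trans C.lt
      have h4 : (b - σ) * (b - x₀) < 0 := by nlinarith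
      have h5 : b < x₀ := by
        by_contra h6
        rw [not_lt] at h6
        have := hx₀.1
        nlinarith
      nlinarith
  obtain ⟨x₀, hx₀, hφ, hψ⟩ := start
  have hx0 : 0 < x₀ := hσ0.trans_le hx₀
  -- At distance at least `2 α + 3` from `σ` the quadratic term alone exceeds `2 α + 2`.
  have hend : 0 ≤ psi α (x₀ + 2 * α + 3) σ := by
    have h1 : 0 ≤ 2 * α * √(σ / (x₀ + 2 * α + 3)) := by positivity
    rw [psi]
    nlinarith [mul_pos hσ0 hα]
  have hcont : ContinuousOn (fun x => psi α x σ) (Icc x₀ (x₀ + 2 * α + 3)) :=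
    continuousOn_psi.mono fun x hx => hx0.trans_le hx.1
  obtain ⟨x, hx, h0⟩ := intermediate_value_Icc (by linarith) hcont ⟨hψ, hend⟩
  simp only at h0
  refine ⟨x, lt_of_le_of_ne (hx₀.trans hx.1) ?_, ?_, h0⟩
  · rintro rfl
    rw [psi, div_self hσ0.ne', Real.sqrt_one] at h0
    linarith
  · rcases hx.1.eq_or_lt with rfl | h
    · exact hφ
    · exact hφ.trans (phi_lt_phi hα.le hσ0 hx0 h).le

lemma hardDensity_zero (σ b : ℝ) : hardDensity 0 σ b = hardDensityZero σ b := by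
  ext x; simp [hardDensity, hardDensityZero]

/-- Here `√(a b)` is the root of a negative number, `0` by convention, but the coefficient `α / √(a
b)` is `0` anyway as `α = 0`. -/
lemma softDensity_zero : softDensity 0 (-√2) √2 = semicircleDensity := by
  ext x
  have h : (√2 - x) * (x - -√2) = 2 - x ^ 2 := by
    have := Real.sq_sqrt (zero_le_two (α := ℝ))
    linear_combination this
  simp only [softDensity, semicircleDensity, h]
  simp

lemma phi_zero (x a : ℝ) : phi 0 x a = x + a := by simp [phi]

lemma psi_zero (x a : ℝ) : psi 0 x a = 3 / 4 * (x - a) ^ 2 + a * (x - a) - 2 := by simp [psi]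

lemma IsEquilibriumMeasure.unique {Q : ℝ → EReal} {S : Set ℝ} {μ ν : Measure ℝ}
    (hμ : IsEquilibriumMeasure Q S μ) (hν : IsEquilibriumMeasure Q S ν) : μ = ν :=
  hν.2.2 μ hμ.1 hμ.2.1

end LogEquilibrium

/-! ### Assembly of the cases. -/

theorem theorem2p4 :
    (∀ α : ℝ, 0 < α →
      ∃ a_c b_c : ℝ,
        -- the critical pair is the unique solution of the critical equations
        (0 < a_c ∧ a_c < √α ∧ √α < b_c ∧
          LogEquilibrium.phi α b_c a_c = 0 ∧ LogEquilibrium.psi α b_c a_c = 0 ∧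
          b_c = 2 / 3 * (√(6 * (α + 1) - 2 * a_c ^ 2) - a_c / 2)) ∧
        (∀ a b : ℝ, 0 < a → a < b →
          LogEquilibrium.phi α b a = 0 → LogEquilibrium.psi α b a = 0 → a = a_c ∧ b = b_c) ∧
        -- (1) the case `σ = 0`
        ((∀ x ∈ Set.Icc a_c b_c, 0 ≤ LogEquilibrium.softDensity α a_c b_c x) ∧
          (LogEquilibrium.densityMeasure (Set.Icc a_c b_c)
            (LogEquilibrium.softDensity α a_c b_c)).support = Set.Icc a_c b_c ∧
          LogEquilibrium.IsEquilibriumMeasure (LogEquilibrium.extField α) (Set.Ici 0)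
            (LogEquilibrium.densityMeasure (Set.Icc a_c b_c)
              (LogEquilibrium.softDensity α a_c b_c))) ∧
        (∀ a b : ℝ, 0 < a → a < √α → √α < b →
          LogEquilibrium.IsEquilibriumMeasure (LogEquilibrium.extField α) (Set.Ici 0)
            (LogEquilibrium.densityMeasure (Set.Icc a b) (LogEquilibrium.softDensity α a b)) →
          a = a_c ∧ b = b_c) ∧
        -- (2) the case `0 < σ ≤ a_c`
        (∀ σ : ℝ, 0 < σ → σ ≤ a_c →
          LogEquilibrium.IsEquilibriumMeasure (LogEquilibrium.extField α) (Set.Ici σ)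
            (LogEquilibrium.densityMeasure (Set.Icc a_c b_c)
              (LogEquilibrium.softDensity α a_c b_c))) ∧
        -- (3) the case `σ > a_c`
        (∀ σ : ℝ, a_c < σ →
          (∃! b : ℝ, σ < b ∧ 0 ≤ LogEquilibrium.phi α b σ ∧ LogEquilibrium.psi α b σ = 0) ∧
          ∀ b : ℝ, σ < b → 0 ≤ LogEquilibrium.phi α b σ → LogEquilibrium.psi α b σ = 0 →
            (∀ x ∈ Set.Ioc σ b, 0 ≤ LogEquilibrium.hardDensity α σ b x) ∧
            (LogEquilibrium.densityMeasure (Set.Ioc σ b)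
              (LogEquilibrium.hardDensity α σ b)).support = Set.Icc σ b ∧
            LogEquilibrium.IsEquilibriumMeasure (LogEquilibrium.extField α) (Set.Ici σ)
              (LogEquilibrium.densityMeasure (Set.Ioc σ b)
                (LogEquilibrium.hardDensity α σ b)))) ∧
    -- (4) (a) the case `α = 0`, `σ ≥ -√2`
    (∀ σ b : ℝ, -√2 ≤ σ → b = 2 / 3 * (√(σ ^ 2 + 6) + σ / 2) →
      σ < b ∧
      (∀ x ∈ Set.Ioc σ b, 0 ≤ LogEquilibrium.hardDensityZero σ b x) ∧
      (LogEquilibrium.densityMeasure (Set.Ioc σ b)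
        (LogEquilibrium.hardDensityZero σ b)).support = Set.Icc σ b ∧
      LogEquilibrium.IsEquilibriumMeasure (LogEquilibrium.extField 0) (Set.Ici σ)
        (LogEquilibrium.densityMeasure (Set.Ioc σ b) (LogEquilibrium.hardDensityZero σ b))) ∧
    -- (4) (b) the case `α = 0`, `σ ≤ -√2`
    (LogEquilibrium.densityMeasure (Set.Icc (-√2) √2)
        LogEquilibrium.semicircleDensity).support = Set.Icc (-√2) √2 ∧
    (∀ σ : ℝ, σ ≤ -√2 →
      LogEquilibrium.IsEquilibriumMeasure (LogEquilibrium.extField 0) (Set.Ici σ)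
        (LogEquilibrium.densityMeasure (Set.Icc (-√2) √2)
          LogEquilibrium.semicircleDensity)) := by
  refine ⟨fun α hα => ?_, fun σ b hσ hb => ?_, ?_, fun σ hσ => ?_⟩
  · obtain ⟨a, b, C⟩ := LogEquilibrium.exists_isCritical hα
    have hsqrt := C.lt_sqrt_lt
    have heq : ∀ σ : ℝ, 0 ≤ σ → σ ≤ a → LogEquilibrium.IsEquilibriumMeasure
        (LogEquilibrium.extField α) (Set.Ici σ) (LogEquilibrium.densityMeasure (Set.Icc a b)
          (LogEquilibrium.softDensity α a b)) := fun σ h0 h1 =>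
      LogEquilibrium.isEquilibriumMeasure_softDensity hα.le C.lt (fun _ => C.pos) C.phi_eq
        C.psi_eq h1 fun _ => h0
    have hsupp := LogEquilibrium.support_softDensity hα.le C.lt fun _ => C.pos
    refine ⟨a, b, ⟨C.pos, hsqrt.1, hsqrt.2, C.phi_eq, C.psi_eq, C.right_eq⟩,
      fun a' b' h1 h2 h3 h4 => C.unique ⟨h1, h2, h3, h4⟩,
      ⟨fun x hx => LogEquilibrium.softDensity_nonneg hα.le (fun _ => C.pos) hx.1, hsupp,
        heq 0 le_rfl C.pos.le⟩,
      fun a' b' h1 h2 h3 h4 => ?_, fun σ h1 h2 => heq σ h1.le h2, fun σ hσ => ⟨?_, ?_⟩⟩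
    -- Both measures are the equilibrium measure, so their supports `[a', b']` and `[a, b]`
    -- coincide; compare infimum and supremum.
    · have hab' : a' < b' := h2.trans h3
      have hs' := LogEquilibrium.support_softDensity hα.le hab' fun _ => h1
      rw [h4.unique (heq 0 le_rfl C.pos.le), hsupp] at hs'
      have e1 := congrArg sInf hs'
      have e2 := congrArg sSup hs'
      rw [csInf_Icc C.lt.le, csInf_Icc hab'.le] at e1
      rw [csSup_Icc C.lt.le, csSup_Icc hab'.le] at e2
      exact ⟨e1.symm, e2.symm⟩
    · obtain ⟨x, hx, hφ, hψ⟩ := LogEquilibrium.exists_right_end hα C hσ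
      have hσ0 : 0 < σ := C.pos.trans hσ
      refine ⟨x, ⟨hx, hφ, hψ⟩, fun y hy => ?_⟩
      obtain ⟨hy, hφ', hψ'⟩ := hy
      rcases lt_trichotomy y x with h | h | h
      · have := LogEquilibrium.psi_lt_psi hσ0 hy h hφ'
        linarith
      · exact h
      · have := LogEquilibrium.psi_lt_psi hσ0 hx h hφ
        linarith
    · intro x hx hφ hψ
      have hσ0 : 0 < σ := C.pos.trans hσ
      exact ⟨fun y hy => LogEquilibrium.hardDensity_nonneg hα.le hx (fun _ => hσ0) hφ hψ hy,
        LogEquilibrium.support_hardDensity hα.le hx (fun _ => hσ0) hφ hψ,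
        LogEquilibrium.isEquilibriumMeasure_hardDensity hα.le hx (fun _ => hσ0) hφ hψ⟩
  · have hw2 := Real.sq_sqrt (show (0 : ℝ) ≤ σ ^ 2 + 6 by positivity)
    have hw0 := Real.sqrt_nonneg (σ ^ 2 + 6)
    have h2 := Real.sq_sqrt (zero_le_two (α := ℝ))
    have h20 := Real.sqrt_nonneg (2 : ℝ)
    have hlt : σ < b := by
      have : σ < √(σ ^ 2 + 6) := Real.lt_sqrt_of_sq_lt (by linarith)
      linarith
    have hφ : 0 ≤ LogEquilibrium.phi 0 b σ := by
      rw [LogEquilibrium.phi_zero]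
      -- Here `phi 0 b σ = b + σ`, and for `σ < 0` its nonnegativity amounts to `4 σ² ≤ σ² + 6`,
      -- that is `σ ≥ -√2`.
      have : -2 * σ ≤ √(σ ^ 2 + 6) := by
        rcases le_or_gt 0 σ with h | h
        · linarith
        · exact Real.le_sqrt_of_sq_le (by nlinarith)
      linarith
    have hψ : LogEquilibrium.psi 0 b σ = 0 := by
      rw [LogEquilibrium.psi_zero, hb]
      linear_combination 1 / 3 * hw2
    have h00 : (0 : ℝ) < 0 → 0 < σ := fun h => absurd h (lt_irrefl 0)
    rw [← LogEquilibrium.hardDensity_zero]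
    exact ⟨hlt, fun y hy => LogEquilibrium.hardDensity_nonneg le_rfl hlt h00 hφ hψ hy,
      LogEquilibrium.support_hardDensity le_rfl hlt h00 hφ hψ,
      LogEquilibrium.isEquilibriumMeasure_hardDensity le_rfl hlt h00 hφ hψ⟩
  · have h20 : 0 < √(2 : ℝ) := Real.sqrt_pos.2 two_pos
    rw [← LogEquilibrium.softDensity_zero]
    exact LogEquilibrium.support_softDensity le_rfl (by linarith)
      fun h => absurd h (lt_irrefl 0)
  · have h20 : 0 < √(2 : ℝ) := Real.sqrt_pos.2 two_pos
    have h2 := Real.sq_sqrt (zero_le_two (α := ℝ))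
    rw [← LogEquilibrium.softDensity_zero]
    refine LogEquilibrium.isEquilibriumMeasure_softDensity le_rfl (by linarith)
      (fun h => absurd h (lt_irrefl 0)) ?_ ?_ hσ fun h => absurd h (lt_irrefl 0)
    · rw [LogEquilibrium.phi_zero]; ring
    · rw [LogEquilibrium.psi_zero]
      linear_combination h2
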